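/- Let $n\ge 0$, let $T:\mathbb{R}^n\to\mathbb{R}^n$ be $1$-Lipschitz for the Euclidean norm, let $X$ be an $\mathbb{R}^n$-valued random vector, let $Z$ be a standard Gaussian random vector in $\mathbb{R}^n$ independent of $X$, and let $s>0$. Let $\alpha\in[0,\infty]$, and if $\alpha<1$ assume in addition that $\mathbb{E}\|X\|_2<\infty$. Then the Rényi entropies of order $\alpha$ of $X+\sqrt{s}\,Z$ and of $T(X)+\sqrt{s}\,Z$ exist in $[-\infty,\infty]$, and $$h_\alpha(X+\sqrt{s}\,Z)\;\ge\; h_\alpha(T(X)+\sqrt{s}\,Z).$$ Here, for a random vector $Y$ in $\mathbb{R}^n$ with density $f$ with respect to Lebesgue measure, $h_\alpha(Y)=\frac{1}{1-\alpha}\log\int_{\mathbb{R}^n} f^\alpha\,dx$ for $\alpha\in(0,1)\cup(1,\infty)$, $h_0(Y)=\log\mathrm{vol}(\{f>0\})$, $h_\infty(Y)=-\log\|f\|_{\infty}$ (essential supremum), and $h_1(Y)=-\int_{\mathbb{R}^n} f\log f\,dx$, with $\log 0=-\infty$, $\log\infty=\infty$ and $0\log 0=0$. Existence of $h_\alpha(Y)$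 means that $Y$ has a density $f$ and, for $\alpha=1$, that the integral $-\int f\log f\,dx$ exists in $[-\infty,\infty]$ (its positive and negative parts do not both have infinite integral). -/

import Mathlib

open MeasureTheory ProbabilityTheory
open scoped ENNReal

noncomputable section

/-- The positive part of the Shannon integral, `∫ (-f log f)⁺ dx`, as an extended nonnegative
real. -/
def shannonPos {E : Type*} [MeasureSpace E] (f : E → ℝ≥0∞) : ℝ≥0∞ :=
  ∫⁻ x, ENNReal.ofReal (Real.negMulLog (f x).toReal)

/-- The negative part of the Shannon integral, `∫ (-f log f)⁻ dx`, as an extended nonnegative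
real. -/
def shannonNeg {E : Type*} [MeasureSpace E] (f : E → ℝ≥0∞) : ℝ≥0∞ :=
  ∫⁻ x, ENNReal.ofReal (-Real.negMulLog (f x).toReal)

/-- The Rényi entropy `h_α(f) ∈ [-∞, ∞]` of order `α ∈ [0, ∞]` of a density `f`:
* `h_0(f) = log vol {f ≠ 0}`;
* `h_1(f) = -∫ f log f`, the extended-valued integral being the difference of the integrals of
  the positive and negative parts (meaningful if these are not both infinite);
* `h_∞(f) = -log ‖f‖_∞`, with the essential supremum;
* `h_α(f) = (1 - α)⁻¹ log ∫ f ^ α` for all other `α`.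
Here `log 0 = -∞` and `log ∞ = ∞`. -/
def renyiEntropyOfDensity {E : Type*} [MeasureSpace E] (α : ℝ≥0∞) (f : E → ℝ≥0∞) : EReal :=
  open scoped Classical in
  if α = 0 then ENNReal.log (volume (Function.support f))
  else if α = 1 then (shannonPos f : EReal) - (shannonNeg f : EReal)
  else if α = ∞ then -ENNReal.log (essSup f volume)
  else (((1 - α.toReal)⁻¹ : ℝ) : EReal) * ENNReal.log (∫⁻ x, f x ^ α.toReal)

/-- The Rényi entropy of order `α` of a law `μ`, computed from its Lebesgue density. -/
def renyiEntropy {E : Type*} [MeasureSpace E] (α : ℝ≥0∞) (μ : Measure E) : EReal :=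
  renyiEntropyOfDensity α (μ.rnDeriv volume)

/-- The Rényi entropy of order `α` of the law `μ` exists: `μ` has a Lebesgue density `f` and, when
`α = 1`, the integral `-∫ f log f` exists as an element of `[-∞, ∞]`. -/
def HasRenyiEntropy {E : Type*} [MeasureSpace E] (α : ℝ≥0∞) (μ : Measure E) : Prop :=
  μ ≪ volume ∧
    (α = 1 → shannonPos (μ.rnDeriv volume) ≠ ∞ ∨ shannonNeg (μ.rnDeriv volume) ≠ ∞)

end

/-! With `b = 1 / (2s)`, the densities of `X + √s Z` and `T(X) + √s Z` are normalised mixtures `f`,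
`g` of Gaussians `exp (-b ‖x - y‖²)` and `exp (-b ‖x - T y‖²)` over the law of `X`. Let `γ` be the
centred Gaussian density. On `E × E` the product `f ⊗ γ` is a mixture with centres `(y, 0)`, and `g
⊗ γ` is, after swapping coordinates, one with centres `(0, T y)`. Doubling the dimension gives room
for the motion `(cos t • y, sin t • T y)`, along which all mutual distances of centres decrease
because `T` is a contraction (`inner_contractionPath_nonpos`).

Along such a motion a finite mixture `m` concentrates: `∫ m κ(m)` increases for every increasing
`C¹` function `κ` vanishing near `0`. By the continuity equation its derivative is the integral of
`κ'(m)` times a double sum over pairs of centres, which symmetrisation shows to be nonnegative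
(`flux_identity`, `sum_sum_mul_inner_nonneg`, `monotoneOn_integral_gaussMixture`). Approximating the
law of `X` by finitely supported laws, and indicators of `(c, ∞)` by such `κ`, shows that the mass
on superlevel sets grows from `f ⊗ γ` to `g ⊗ γ` (`densityLaw_gaussMix_mul_gaussBump_Ioi_le`).

Equivalently, the value of the density `f ⊗ γ`, sampled under that density, is stochastically
dominated by the corresponding value for `g ⊗ γ`. Integrating the monotone functions `r ^ (α - 1)`
and `-log r` compares the entropies of the products. These integrals factor, or add up for the
logarithm, and the finite contribution of `γ` cancels. Order `∞` is read off from the superlevel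
sets directly, and at order `0` both supports are the whole space. -/

open Set Filter Topology Real InnerProductSpace

/-! ### Gaussian bumps and finite Gaussian mixtures: decay, derivatives, symmetrisation -/

section Core

variable {V : Type*} [NormedAddCommGroup V]

/-- The unnormalised Gaussian `exp (-b ‖z‖²)`. -/
noncomputable def gaussBump (b : ℝ) (z : V) : ℝ := Real.exp (-b * ‖z‖ ^ 2)

lemma gaussBump_pos (b : ℝ) (z : V) : 0 < gaussBump b z := Real.exp_pos _

lemma gaussBump_le_one {b : ℝ} (hb : 0 ≤ b) (z : V) : gaussBump b z ≤ 1 :=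
  Real.exp_le_one_iff.2 (by nlinarith [mul_nonneg hb (sq_nonneg ‖z‖)])

variable {ι : Type*} [Fintype ι]

/-- The Gaussian mixture `∑ᵢ pᵢ exp (-b ‖x - zᵢ‖²)`. -/
noncomputable def gaussMixture (b : ℝ) (p : ι → ℝ) (z : ι → V) (x : V) : ℝ :=
  ∑ i, p i * gaussBump b (x - z i)

/-- The radius depends on the centres only through the bound `A`, so one ball serves for a whole
compact time interval of moving centres. Functions of the mixture that vanish below level `c` are
then compactly supported, uniformly in time. -/
lemma exists_gaussMixture_lt {b : ℝ} (hb : 0 < b) {p : ι → ℝ} (hp : ∀ i, 0 ≤ p i) (A : ℝ) {c : ℝ}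
    (hc : 0 < c) : ∃ R, ∀ z : ι → V, (∀ i, ‖z i‖ ≤ A) →
    ∀ x, R ≤ ‖x‖ → gaussMixture b p z x < c := by
  have hlim : Tendsto (fun y : ℝ => (∑ i, p i) * Real.exp (-b * y ^ 2)) atTop (𝓝 0) := by
    have h1 : Tendsto (fun y : ℝ => -b * y ^ 2) atTop atBot :=
      (tendsto_pow_atTop two_ne_zero).const_mul_atTop_of_neg (neg_lt_zero.2 hb)
    simpa using (Real.tendsto_exp_atBot.comp h1).const_mul (∑ i, p i)
  obtain ⟨y, hy, hy0⟩ := ((hlim.eventually_lt_const hc).and (eventually_ge_atTop 0)).exists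
  refine ⟨A + y, fun z hz x hx => lt_of_le_of_lt ?_ hy⟩
  rw [gaussMixture, Finset.sum_mul]
  refine Finset.sum_le_sum fun i _ => mul_le_mul_of_nonneg_left ?_ (hp i)
  have h1 : y ≤ ‖x - z i‖ := by linarith [norm_sub_norm_le x (z i), hz i]
  have h2 : y ^ 2 ≤ ‖x - z i‖ ^ 2 := by gcongr
  exact Real.exp_le_exp.2 (by nlinarith)

variable [InnerProductSpace ℝ V]

lemma contDiff_gaussBump (b : ℝ) {n : ℕ∞} : ContDiff ℝ n (gaussBump b : V → ℝ) := by
  unfold gaussBump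
  exact (contDiff_const.mul (contDiff_norm_sq ℝ)).exp

lemma continuous_gaussBump (b : ℝ) : Continuous (gaussBump b : V → ℝ) :=
  (contDiff_gaussBump (n := 0) b).continuous

lemma hasFDerivAt_gaussBump (b : ℝ) (z : V) :
    HasFDerivAt (gaussBump b) ((-(2 * b) * gaussBump b z) • innerSL ℝ z) z := by
  have h := ((hasStrictFDerivAt_norm_sq z).hasFDerivAt.const_mul (-b)).exp
  refine h.congr_fderiv ?_
  ext w
  simp [gaussBump]
  ring

/-- Integration by parts against the constant `1`; this is the divergence theorem for the flux
below. -/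
lemma integral_fderiv_apply_eq_zero [FiniteDimensional ℝ V] [MeasurableSpace V] [BorelSpace V]
    {μ : Measure V} [μ.IsAddHaarMeasure] {g : V → ℝ} (hg : ContDiff ℝ 1 g)
    (hc : HasCompactSupport g) (w : V) : ∫ x, fderiv ℝ g x w ∂μ = 0 := by
  have h := integral_mul_fderiv_eq_neg_fderiv_mul_of_integrable (μ := μ) (f := fun _ : V => (1 : ℝ))
    (g := g) (v := w) (by simp) ?_ ?_ (by simp) (fun x _ => hg.differentiable (by simp) x)
  · simpa using h
  · simp only [one_mul]
    refine Continuous.integrable_of_hasCompactSupport ?_ (hc.fderiv_apply (𝕜 := ℝ) w)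
    exact (hg.continuous_fderiv (by simp)).clm_apply continuous_const
  · simpa using hg.continuous.integrable_of_hasCompactSupport hc

lemma contDiff_gaussMixture (b : ℝ) (p : ι → ℝ) (z : ι → V) {n : ℕ∞} :
    ContDiff ℝ n (gaussMixture b p z) :=
  ContDiff.sum fun _ _ => contDiff_const.mul
    ((contDiff_gaussBump b).comp (contDiff_id.sub contDiff_const))

lemma hasFDerivAt_gaussBump_sub (b : ℝ) (z x : V) :
    HasFDerivAt (fun x => gaussBump b (x - z))
      ((-(2 * b) * gaussBump b (x - z)) • innerSL ℝ (x - z)) x := by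
  have h := (hasFDerivAt_gaussBump b (x - z)).comp x ((hasFDerivAt_id x).sub_const z)
  rwa [ContinuousLinearMap.comp_id] at h

lemma hasDerivAt_gaussBump_sub (b : ℝ) {z : ℝ → V} {v : V} {t : ℝ} (hz : HasDerivAt z v t)
    (x : V) :
    HasDerivAt (fun t => gaussBump b (x - z t))
      (2 * b * gaussBump b (x - z t) * ⟪x - z t, v⟫_ℝ) t := by
  have h := (hasFDerivAt_gaussBump b (x - z t)).comp_hasDerivAt t (hz.const_sub x)
  refine h.congr_deriv ?_
  simp [inner_sub_left]
  ring

lemma hasFDerivAt_gaussMixture (b : ℝ) (p : ι → ℝ) (z : ι → V) (x : V) :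
    HasFDerivAt (gaussMixture b p z)
      (∑ i, p i • ((-(2 * b) * gaussBump b (x - z i)) • innerSL ℝ (x - z i))) x :=
  HasFDerivAt.fun_sum fun i _ => (hasFDerivAt_gaussBump_sub b (z i) x).const_mul (p i)

lemma hasDerivAt_gaussMixture (b : ℝ) (p : ι → ℝ) {z : ι → ℝ → V} {v : ι → V} {t : ℝ}
    (hz : ∀ i, HasDerivAt (z i) (v i) t) (x : V) :
    HasDerivAt (fun t => gaussMixture b p (fun i => z i t) x)
      (∑ i, p i * (2 * b * gaussBump b (x - z i t) * ⟪x - z i t, v i⟫_ℝ)) t :=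
  HasDerivAt.fun_sum fun i _ => (hasDerivAt_gaussBump_sub b (hz i) x).const_mul (p i)

/-- The double sum controlling the divergence of the velocity field of a Gaussian mixture. -/
lemma sum_sum_mul_inner_nonneg (q : ι → ℝ) (hq : ∀ i, 0 ≤ q i) (z v : ι → V)
    (h : ∀ i j, ⟪z i - z j, v i - v j⟫_ℝ ≤ 0) :
    0 ≤ ∑ i, ∑ j, q i * q j * ⟪z j - z i, v i⟫_ℝ := by
  have hs : ∑ i, ∑ j, q i * q j * ⟪z j - z i, v i⟫_ℝ
      = ∑ i, ∑ j, q i * q j * ⟪z i - z j, v j⟫_ℝ := by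
    rw [Finset.sum_comm]
    exact Finset.sum_congr rfl fun i _ => Finset.sum_congr rfl fun j _ => by ring
  have h2 : 0 ≤ ∑ i, ∑ j, q i * q j * ⟪z j - z i, v i⟫_ℝ
      + ∑ i, ∑ j, q i * q j * ⟪z i - z j, v j⟫_ℝ := by
    rw [← Finset.sum_add_distrib]
    refine Finset.sum_nonneg fun i _ => ?_
    rw [← Finset.sum_add_distrib]
    refine Finset.sum_nonneg fun j _ => ?_
    have e : q i * q j * ⟪z j - z i, v i⟫_ℝ + q i * q j * ⟪z i - z j, v j⟫_ℝ
        = q i * q j * -⟪z i - z j, v i - v j⟫_ℝ := by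
      rw [inner_sub_right, ← neg_sub (z i) (z j), inner_neg_left]; ring
    rw [e]
    exact mul_nonneg (mul_nonneg (hq i) (hq j)) (neg_nonneg.2 (h i j))
  linarith

end Core

/-! ### Monotonicity of `∫ m κ(m)` under contracting motion of the centres -/

section Flow

variable {V : Type*} [NormedAddCommGroup V] [InnerProductSpace ℝ V] {ι : Type*} [Fintype ι]

lemma deriv_eq_zero_of_forall_le {κ : ℝ → ℝ} {c r : ℝ} (hκ : ∀ r ≤ c, κ r = 0) (hr : r < c) :
    deriv κ r = 0 := by
  have h : κ =ᶠ[𝓝 r] fun _ => 0 := by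
    filter_upwards [Iio_mem_nhds hr] with y hy using hκ y (le_of_lt hy)
  rw [h.deriv_eq, deriv_const]

/-- The time derivative of `∑ᵢ pᵢ exp (-b ‖x - zᵢ‖²)` when the centres `zᵢ` have velocities
`vᵢ`. -/
noncomputable def gaussMixtureDeriv (b : ℝ) (p : ι → ℝ) (z v : ι → V) (x : V) : ℝ :=
  ∑ i, p i * (2 * b * gaussBump b (x - z i) * ⟪x - z i, v i⟫_ℝ)

/-- The continuity equation for Gaussian mixtures: the time derivative of `f κ(f)` plus the
divergence of its flux, as a double sum over the centres; here `k = κ(f)` and `k' = κ'(f)`. -/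
lemma flux_identity (b k k' : ℝ) (p B : ι → ℝ) (z v : ι → V) (x : V) :
    (∑ i, p i * (2 * b * B i * ⟪x - z i, v i⟫_ℝ)) * k
      + (∑ i, p i * B i) * (k' * ∑ i, p i * (2 * b * B i * ⟪x - z i, v i⟫_ℝ))
      + ∑ i, (k * (p i * (-(2 * b) * B i * ⟪x - z i, v i⟫_ℝ))
        + k' * (∑ j, p j * (-(2 * b) * B j * ⟪x - z j, v i⟫_ℝ)) * (p i * B i))
    = 2 * b * k' * ∑ i, ∑ j, (p i * B i) * (p j * B j) * ⟪z j - z i, v i⟫_ℝ := by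
  have h1 : ∀ i j, (p i * B i) * (p j * B j) * ⟪z j - z i, v i⟫_ℝ
      = (p i * B i) * (p j * B j) * ⟪x - z i, v i⟫_ℝ
        - (p i * B i) * (p j * B j) * ⟪x - z j, v i⟫_ℝ := by
    intro i j
    rw [← mul_sub, ← inner_sub_left]
    congr 2
    abel
  have h2 : (∑ i, p i * B i) * (k' * ∑ i, p i * (2 * b * B i * ⟪x - z i, v i⟫_ℝ))
      = 2 * b * k' * ∑ i, ∑ j, (p i * B i) * (p j * B j) * ⟪x - z i, v i⟫_ℝ := by
    rw [mul_left_comm, mul_comm (∑ i, p i * B i), Finset.sum_mul_sum, Finset.mul_sum,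
      Finset.mul_sum]
    refine Finset.sum_congr rfl fun i _ => ?_
    rw [Finset.mul_sum, Finset.mul_sum]
    exact Finset.sum_congr rfl fun j _ => by ring
  have h3 : ∑ i, (k * (p i * (-(2 * b) * B i * ⟪x - z i, v i⟫_ℝ))
        + k' * (∑ j, p j * (-(2 * b) * B j * ⟪x - z j, v i⟫_ℝ)) * (p i * B i))
      = -(∑ i, p i * (2 * b * B i * ⟪x - z i, v i⟫_ℝ)) * k
        - 2 * b * k' * ∑ i, ∑ j, (p i * B i) * (p j * B j) * ⟪x - z j, v i⟫_ℝ := by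
    rw [Finset.sum_add_distrib, sub_eq_add_neg]
    congr 1
    · rw [← Finset.sum_neg_distrib, Finset.sum_mul]
      exact Finset.sum_congr rfl fun i _ => by ring
    · simp only [Finset.mul_sum, Finset.sum_mul, ← Finset.sum_neg_distrib]
      exact Finset.sum_congr rfl fun i _ => Finset.sum_congr rfl fun j _ => by ring
  rw [h2, h3]
  simp_rw [h1, Finset.sum_sub_distrib]
  ring

variable [FiniteDimensional ℝ V] [MeasurableSpace V] [BorelSpace V] {μ : Measure V}
  [μ.IsAddHaarMeasure]

/-- The divergence of the flux `κ(m) ∑ pᵢ exp (-b ‖x - zᵢ‖²) vᵢ` has integral zero. Once it is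
added, `flux_identity` cancels every term containing `κ(m)` undifferentiated, and what remains is
pointwise nonnegative. -/
lemma integral_gaussMixture_deriv_nonneg {b : ℝ} (hb : 0 < b) {p : ι → ℝ} (hp : ∀ i, 0 ≤ p i)
    (z v : ι → V) (h : ∀ i j, ⟪z i - z j, v i - v j⟫_ℝ ≤ 0) {κ : ℝ → ℝ} (hκ : ContDiff ℝ 1 κ)
    (hmono : Monotone κ) {c : ℝ} (hc : 0 < c) (hκ0 : ∀ r ≤ c, κ r = 0) :
    0 ≤ ∫ x, (gaussMixtureDeriv b p z v x * κ (gaussMixture b p z x)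
      + gaussMixture b p z x
        * (deriv κ (gaussMixture b p z x) * gaussMixtureDeriv b p z v x)) ∂μ := by
  set m := gaussMixture b p z with hm
  set m' := gaussMixtureDeriv b p z v with hm'
  obtain ⟨A, hA⟩ : ∃ A, ∀ i, ‖z i‖ ≤ A :=
    ⟨∑ i, ‖z i‖, fun i => Finset.single_le_sum (f := fun i => ‖z i‖)
      (fun i _ => norm_nonneg _) (Finset.mem_univ i)⟩
  obtain ⟨R, hR⟩ := exists_gaussMixture_lt (V := V) hb hp A hc
  have hcm : ContDiff ℝ 1 m := contDiff_gaussMixture (n := 1) b p z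
  have hcm' : Continuous m' := by
    refine continuous_finsetSum _ fun i _ => continuous_const.mul ((continuous_const.mul
      ((continuous_gaussBump b).comp (continuous_id.sub continuous_const))).mul ?_)
    exact (continuous_id.sub continuous_const).inner continuous_const
  have hcd : Continuous (deriv κ) := hκ.continuous_deriv le_rfl
  have hsupp : ∀ x, x ∉ Metric.closedBall (0 : V) R → m x < c := by
    intro x hx
    refine hR z hA x ?_
    simpa using (not_le.1 (by simpa using hx) : R < ‖x‖).le
  have hcs : ∀ g : V → ℝ, (∀ x, m x < c → g x = 0) → HasCompactSupport g := fun g hg =>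
    HasCompactSupport.intro (isCompact_closedBall 0 R) fun x hx => hg x (hsupp x hx)
  let G : ι → V → ℝ := fun i x => κ (m x) * (p i * gaussBump b (x - z i))
  have hGc : ∀ i, ContDiff ℝ 1 (G i) := fun i => (hκ.comp hcm).mul (contDiff_const.mul
    ((contDiff_gaussBump (n := 1) b).comp (contDiff_id.sub contDiff_const)))
  have hGs : ∀ i, HasCompactSupport (G i) := fun i => hcs _ fun x hx => by
    simp [G, hκ0 _ hx.le]
  have hGd : ∀ i x, fderiv ℝ (G i) x (v i)
      = κ (m x) * (p i * (-(2 * b) * gaussBump b (x - z i) * ⟪x - z i, v i⟫_ℝ))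
        + deriv κ (m x) * (∑ j, p j * (-(2 * b) * gaussBump b (x - z j) * ⟪x - z j, v i⟫_ℝ))
          * (p i * gaussBump b (x - z i)) := by
    intro i x
    have h1 := ((hκ.differentiable (by simp) (m x)).hasDerivAt.comp_hasFDerivAt x
      (hasFDerivAt_gaussMixture b p z x)).mul
      ((hasFDerivAt_gaussBump_sub b (z i) x).const_mul (p i))
    rw [show fderiv ℝ (G i) x = _ from h1.fderiv]
    simp [inner_sub_left]
    ring
  have hint : ∀ i, Integrable (fun x => fderiv ℝ (G i) x (v i)) μ := fun i =>
    Continuous.integrable_of_hasCompactSupport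
      (((hGc i).continuous_fderiv (by simp)).clm_apply continuous_const)
      ((hGs i).fderiv_apply (𝕜 := ℝ) (v i))
  have hint0 : Integrable (fun x => m' x * κ (m x) + m x * (deriv κ (m x) * m' x)) μ := by
    refine Continuous.integrable_of_hasCompactSupport ?_ (hcs _ fun x hx => ?_)
    · have := hcm.continuous
      have := hκ.continuous
      fun_prop
    · simp [hκ0 _ hx.le, deriv_eq_zero_of_forall_le hκ0 hx]
  have hsum : ∫ x, (m' x * κ (m x) + m x * (deriv κ (m x) * m' x)) ∂μ
      = ∫ x, ((m' x * κ (m x) + m x * (deriv κ (m x) * m' x))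
        + ∑ i, fderiv ℝ (G i) x (v i)) ∂μ := by
    rw [integral_add hint0 (integrable_finsetSum _ fun i _ => hint i),
      integral_finsetSum _ fun i _ => hint i]
    simp [integral_fderiv_apply_eq_zero (hGc _) (hGs _)]
  rw [hsum]
  refine integral_nonneg fun x => ?_
  have key := flux_identity b (κ (m x)) (deriv κ (m x)) p (fun i => gaussBump b (x - z i)) z v x
  simp only [hGd]
  refine le_of_le_of_eq ?_ key.symm
  have h0 := sum_sum_mul_inner_nonneg (fun i => p i * gaussBump b (x - z i))
    (fun i => mul_nonneg (hp i) (gaussBump_pos _ _).le) z v h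
  have := hmono.deriv_nonneg (x := m x)
  positivity

/-- Differentiation under the integral sign for functions with a common compact support. -/
lemma hasDerivAt_integral_of_isCompact_support {X : Type*} [TopologicalSpace X] [T2Space X]
    [MeasurableSpace X] [OpensMeasurableSpace X] [SecondCountableTopologyEither X ℝ]
    {μ : Measure X} [IsFiniteMeasureOnCompacts μ] {g D : ℝ → X → ℝ}
    (hg : ∀ t, Continuous (g t)) (hD : Continuous fun q : ℝ × X => D q.1 q.2)
    (hderiv : ∀ x t, HasDerivAt (fun t => g t x) (D t x) t) {t : ℝ} {K : Set ℝ}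
    (hK : IsCompact K) (hKt : K ∈ 𝓝 t) {B : Set X} (hB : IsCompact B)
    (hg0 : ∀ t ∈ K, ∀ x ∉ B, g t x = 0) (hD0 : ∀ t ∈ K, ∀ x ∉ B, D t x = 0) :
    HasDerivAt (fun t => ∫ x, g t x ∂μ) (∫ x, D t x ∂μ) t := by
  obtain ⟨M, hM⟩ := (hK.prod hB).exists_bound_of_continuousOn hD.continuousOn
  have htK : t ∈ K := mem_of_mem_nhds hKt
  refine (hasDerivAt_integral_of_dominated_loc_of_deriv_le (F' := D) (s := K)
    (bound := B.indicator (fun _ => M)) hKt ?_ ?_ ?_ ?_ ?_ ?_).2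
  · exact Eventually.of_forall fun t => (hg t).aestronglyMeasurable
  · exact (hg t).integrable_of_hasCompactSupport (HasCompactSupport.intro hB (hg0 t htK))
  · exact (Continuous.comp (g := fun q : ℝ × X => D q.1 q.2) hD
      (Continuous.prodMk_right t)).aestronglyMeasurable
  · refine Eventually.of_forall fun x t ht => ?_
    by_cases hx : x ∈ B
    · rw [indicator_of_mem hx]
      exact hM (t, x) ⟨ht, hx⟩
    · simp [hD0 t ht x hx, indicator_of_notMem hx]
  · exact (integrable_indicator_iff hB.measurableSet).2 (integrableOn_const hB.measure_lt_top.ne)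
  · exact Eventually.of_forall fun x t _ => hderiv x t

/-- If the distances between the centres of a Gaussian mixture `f` decrease, then `∫ f κ(f)`
increases, for every increasing `κ`. -/
theorem monotoneOn_integral_gaussMixture {b : ℝ} (hb : 0 < b) {p : ι → ℝ} (hp : ∀ i, 0 ≤ p i)
    {z v : ι → ℝ → V} (hz : ∀ i t, HasDerivAt (z i) (v i t) t) (hv : ∀ i, Continuous (v i))
    {t₀ t₁ : ℝ} (h : ∀ t ∈ Icc t₀ t₁, ∀ i j, ⟪z i t - z j t, v i t - v j t⟫_ℝ ≤ 0) {κ : ℝ → ℝ}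
    (hκ : ContDiff ℝ 1 κ) (hmono : Monotone κ) {c : ℝ} (hc : 0 < c) (hκ0 : ∀ r ≤ c, κ r = 0) :
    MonotoneOn (fun t => ∫ x, gaussMixture b p (fun i => z i t) x
      * κ (gaussMixture b p (fun i => z i t) x) ∂μ) (Icc t₀ t₁) := by
  set m : ℝ → V → ℝ := fun t => gaussMixture b p (fun i => z i t) with hm
  set m' : ℝ → V → ℝ := fun t => gaussMixtureDeriv b p (fun i => z i t) (fun i => v i t) with hm'
  have hzc : ∀ i, Continuous (z i) := fun i =>
    continuous_iff_continuousAt.2 fun t => (hz i t).continuousAt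
  have hmc : Continuous fun q : ℝ × V => m q.1 q.2 := by
    refine continuous_finsetSum _ fun i _ => continuous_const.mul
      ((continuous_gaussBump b).comp ?_)
    exact continuous_snd.sub ((hzc i).comp continuous_fst)
  have hmc' : Continuous fun q : ℝ × V => m' q.1 q.2 := by
    have h0 : ∀ i, Continuous fun q : ℝ × V => q.2 - z i q.1 :=
      fun i => continuous_snd.sub ((hzc i).comp continuous_fst)
    exact continuous_finsetSum _ fun i _ => continuous_const.mul ((continuous_const.mul
      ((continuous_gaussBump b).comp (h0 i))).mul ((h0 i).inner ((hv i).comp continuous_fst)))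
  have hcκ := hκ.continuous
  have hcd : Continuous (deriv κ) := hκ.continuous_deriv le_rfl
  -- The margin of `1` makes `K` a neighbourhood of every point of `Icc t₀ t₁`, endpoints included,
  -- so that two-sided derivatives are available there.
  set K : Set ℝ := Icc (t₀ - 1) (t₁ + 1) with hK
  obtain ⟨A, hA⟩ : ∃ A, ∀ t ∈ K, ∀ i, ‖z i t‖ ≤ A := by
    obtain ⟨A, hA⟩ := (isCompact_Icc (a := t₀ - 1) (b := t₁ + 1)).exists_bound_of_continuousOn
      (f := fun t => ∑ i, ‖z i t‖) (Continuous.continuousOn (by fun_prop))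
    refine ⟨A, fun t ht i => le_trans ?_ ((le_abs_self _).trans (hA t ht))⟩
    exact Finset.single_le_sum (f := fun i => ‖z i t‖)
      (fun i _ => norm_nonneg _) (Finset.mem_univ i)
  obtain ⟨R, hR⟩ := exists_gaussMixture_lt (V := V) hb hp A hc
  have hsupp : ∀ t ∈ K, ∀ x, x ∉ Metric.closedBall (0 : V) R → m t x < c := by
    intro t ht x hx
    refine hR _ (hA t ht) x ?_
    simpa using (not_le.1 (by simpa using hx) : R < ‖x‖).le
  obtain ⟨D, hD⟩ : ∃ D : ℝ → V → ℝ, D = fun t x =>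
      m' t x * κ (m t x) + m t x * (deriv κ (m t x) * m' t x) :=
    ⟨_, rfl⟩
  have hDc : Continuous fun q : ℝ × V => D q.1 q.2 := by
    rw [hD]
    exact (hmc'.mul (hcκ.comp hmc)).add (hmc.mul ((hcd.comp hmc).mul hmc'))
  have hder : ∀ t ∈ Icc t₀ t₁, HasDerivAt (fun t => ∫ x, m t x * κ (m t x) ∂μ)
      (∫ x, D t x ∂μ) t := by
    intro t ht
    have hKt : Icc (t₀ - 1) (t₁ + 1) ∈ 𝓝 t :=
      Icc_mem_nhds ((sub_one_lt t₀).trans_le ht.1) (ht.2.trans_lt (lt_add_one t₁))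
    refine hasDerivAt_integral_of_isCompact_support (fun t => ?_) hDc (fun x t => ?_)
      isCompact_Icc hKt (isCompact_closedBall (0 : V) R)
      (fun t ht x hx => ?_) fun t ht x hx => ?_
    · have : Continuous (m t) := (contDiff_gaussMixture (n := 0) b p _).continuous
      exact this.mul (hcκ.comp this)
    · have h1 : HasDerivAt (fun t => m t x) (m' t x) t :=
        hasDerivAt_gaussMixture b p (fun i => hz i t) x
      rw [hD]
      exact h1.mul ((hκ.differentiable (by simp) (m t x)).hasDerivAt.comp t h1)
    · simp [hκ0 _ (hsupp t ht x hx).le]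
    · have := hsupp t ht x hx
      simp [hD, hκ0 _ this.le, deriv_eq_zero_of_forall_le hκ0 this]
  refine monotoneOn_of_deriv_nonneg (convex_Icc t₀ t₁)
    (fun t ht => (hder t ht).continuousAt.continuousWithinAt) (fun t ht => ?_) fun t ht => ?_
  · exact (hder t (interior_subset ht)).differentiableAt.differentiableWithinAt
  · rw [(hder t (interior_subset ht)).deriv, hD]
    exact integral_gaussMixture_deriv_nonneg hb hp _ _ (h t (interior_subset ht)) hκ hmono hc hκ0

end Flow

/-! ### Gaussian mixtures over a general probability measure -/

section Mixture

variable {E V : Type*} [MeasurableSpace E] [NormedAddCommGroup V] [InnerProductSpace ℝ V]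

/-- The Gaussian mixture `∫ exp (-b ‖x - S y‖²) dμ(y)`. -/
noncomputable def gaussMix (b : ℝ) (μ : Measure E) (S : E → V) (x : V) : ℝ :=
  ∫ y, gaussBump b (x - S y) ∂μ

variable [MeasurableSpace V] [BorelSpace V] [FiniteDimensional ℝ V]

omit [FiniteDimensional ℝ V] in
lemma measurable_gaussBump (b : ℝ) : Measurable (gaussBump b : V → ℝ) :=
  (continuous_gaussBump b).measurable

lemma integrable_gaussBump_sub {b : ℝ} (hb : 0 ≤ b) (μ : Measure E) [IsFiniteMeasure μ] {S : E → V}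
    (hS : Measurable S) (x : V) : Integrable (fun y => gaussBump b (x - S y)) μ := by
  refine Integrable.of_bound ((measurable_gaussBump b).comp
    (measurable_const.sub hS)).aestronglyMeasurable 1 (Eventually.of_forall fun y => ?_)
  rw [Real.norm_of_nonneg (gaussBump_pos _ _).le]
  exact gaussBump_le_one hb _

omit [MeasurableSpace V] [BorelSpace V] [FiniteDimensional ℝ V] [InnerProductSpace ℝ V] in
lemma gaussMix_nonneg (b : ℝ) (μ : Measure E) (S : E → V) (x : V) : 0 ≤ gaussMix b μ S x :=
  integral_nonneg fun _ => (gaussBump_pos _ _).le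

lemma gaussMix_pos {b : ℝ} (hb : 0 ≤ b) (μ : Measure E) [IsProbabilityMeasure μ] {S : E → V}
    (hS : Measurable S) (x : V) : 0 < gaussMix b μ S x := by
  refine (integral_pos_iff_support_of_nonneg (fun _ => (gaussBump_pos _ _).le)
    (integrable_gaussBump_sub hb μ hS x)).2 ?_
  rw [show Function.support (fun y => gaussBump b (x - S y)) = univ from
    eq_univ_of_forall fun y => (gaussBump_pos _ _).ne']
  simp

lemma gaussMix_le_one {b : ℝ} (hb : 0 ≤ b) (μ : Measure E) [IsProbabilityMeasure μ] {S : E → V}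
    (hS : Measurable S) (x : V) : gaussMix b μ S x ≤ 1 := by
  have h := integral_mono (μ := μ) (integrable_gaussBump_sub hb μ hS x)
    (integrable_const (1 : ℝ)) fun y => gaussBump_le_one hb _
  rwa [integral_const, probReal_univ, one_smul] at h

lemma continuous_gaussMix {b : ℝ} (hb : 0 ≤ b) (μ : Measure E) [IsProbabilityMeasure μ] {S : E → V}
    (hS : Measurable S) : Continuous (gaussMix b μ S) := by
  refine continuous_of_dominated (bound := fun _ => 1)
    (fun x => (integrable_gaussBump_sub hb μ hS x).aestronglyMeasurable) (fun x => ?_) (by simp) ?_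
  · refine Eventually.of_forall fun y => ?_
    rw [Real.norm_of_nonneg (gaussBump_pos _ _).le]
    exact gaussBump_le_one hb _
  · exact Eventually.of_forall fun y => (continuous_gaussBump b).comp
      (continuous_id.sub continuous_const)

lemma tendsto_gaussMix {b : ℝ} (hb : 0 ≤ b) (μ : Measure E) [IsProbabilityMeasure μ]
    {S : ℕ → E → V} {S' : E → V} (hS : ∀ k, Measurable (S k))
    (hlim : ∀ y, Tendsto (fun k => S k y) atTop (𝓝 (S' y))) (x : V) :
    Tendsto (fun k => gaussMix b μ (S k) x) atTop (𝓝 (gaussMix b μ S' x)) := by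
  refine tendsto_integral_of_dominated_convergence (fun _ => 1)
    (fun k => (integrable_gaussBump_sub hb μ (hS k) x).aestronglyMeasurable) (by simp)
    (fun k => Eventually.of_forall fun y => ?_) (Eventually.of_forall fun y => ?_)
  · rw [Real.norm_of_nonneg (gaussBump_pos _ _).le]
    exact gaussBump_le_one hb _
  · exact ((continuous_gaussBump b).tendsto _).comp (tendsto_const_nhds.sub (hlim y))

lemma ofReal_gaussMix {b : ℝ} (hb : 0 ≤ b) (μ : Measure E) [IsProbabilityMeasure μ] {S : E → V}
    (hS : Measurable S) (x : V) :
    ENNReal.ofReal (gaussMix b μ S x) = ∫⁻ y, ENNReal.ofReal (gaussBump b (x - S y)) ∂μ :=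
  ofReal_integral_eq_lintegral_ofReal (integrable_gaussBump_sub hb μ hS x)
    (Eventually.of_forall fun _ => (gaussBump_pos _ _).le)

lemma integrable_gaussBump {b : ℝ} (hb : 0 < b) : Integrable (gaussBump b : V → ℝ) := by
  have h := (GaussianFourier.integrable_cexp_neg_mul_sq_norm_add (V := V) (b := b)
    (by simpa using hb) 0 0).norm
  refine h.congr (Eventually.of_forall fun v => ?_)
  simp only [gaussBump, Complex.norm_exp]
  congr 1
  simp [← Complex.ofReal_pow]

lemma lintegral_gaussBump_ne_top {b : ℝ} (hb : 0 < b) :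
    ∫⁻ x : V, ENNReal.ofReal (gaussBump b x) ≠ ∞ :=
  (integrable_gaussBump hb).lintegral_lt_top.ne

/-- Tonelli and translation invariance. The total mass does not depend on the centres, which later
allows an integral to be traded for its complement. -/
lemma lintegral_gaussMix {b : ℝ} (hb : 0 ≤ b) (μ : Measure E) [IsProbabilityMeasure μ] {S : E → V}
    (hS : Measurable S) :
    ∫⁻ x, ENNReal.ofReal (gaussMix b μ S x) = ∫⁻ x : V, ENNReal.ofReal (gaussBump b x) := by
  simp_rw [ofReal_gaussMix hb μ hS]
  rw [lintegral_lintegral_swap]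
  · simp_rw [lintegral_sub_right_eq_self (fun x : V => ENNReal.ofReal (gaussBump b x))]
    simp
  · exact (((measurable_gaussBump b).comp
      (measurable_fst.sub (hS.comp measurable_snd))).ennreal_ofReal).aemeasurable

omit [InnerProductSpace ℝ V] [MeasurableSpace V] [BorelSpace V] [FiniteDimensional ℝ V] in
-- Reduces to finite mixtures: the points are the values of `s` and the weights are the masses of
-- its fibres.
lemma gaussMix_simpleFunc_comp (b : ℝ) (μ : Measure E) [IsFiniteMeasure μ] (s : SimpleFunc E E)
    (S : E → V) (x : V) :
    gaussMix b μ (fun y => S (s y)) x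
      = gaussMixture b (fun i : s.range => μ.real (s ⁻¹' {i.1})) (fun i => S i.1) x := by
  classical
  have h : ∀ y, gaussBump b (x - S (s y))
      = ∑ i ∈ s.range, (s ⁻¹' {i}).indicator (fun _ => gaussBump b (x - S i)) y := by
    intro y
    simp only [indicator_apply, mem_preimage, mem_singleton_iff]
    rw [Finset.sum_ite_eq, if_pos (s.mem_range_self y)]
  simp_rw [gaussMix, h]
  rw [integral_finsetSum _ fun i _ => (integrable_const _).indicator (s.measurableSet_fiber i),
    gaussMixture, ← Finset.sum_coe_sort]
  refine Finset.sum_congr rfl fun i _ => ?_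
  rw [integral_indicator_const _ (s.measurableSet_fiber _), smul_eq_mul]

end Mixture

/-! ### The contracting motion in the doubled space -/

section Path

variable {E : Type*} [NormedAddCommGroup E] [InnerProductSpace ℝ E] 

/-- The path `(cos t • y, sin t • T y)` from `(y, 0)` to `(0, T y)`, along which the mutual
distances decrease when `T` is a contraction. -/
noncomputable def contractionPath (T : E → E) (y : E) (t : ℝ) : WithLp 2 (E × E) :=
  cos t • WithLp.toLp 2 (y, 0) + sin t • WithLp.toLp 2 (0, T y)

/-- The velocity of `contractionPath`. -/
noncomputable def contractionVel (T : E → E) (y : E) (t : ℝ) : WithLp 2 (E × E) :=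
  (-sin t) • WithLp.toLp 2 (y, 0) + cos t • WithLp.toLp 2 (0, T y)

lemma hasDerivAt_contractionPath (T : E → E) (y : E) (t : ℝ) :
    HasDerivAt (contractionPath T y) (contractionVel T y t) t :=
  ((hasDerivAt_cos t).smul_const _).add ((hasDerivAt_sin t).smul_const _)

lemma continuous_contractionVel (T : E → E) (y : E) : Continuous (contractionVel T y) := by
  unfold contractionVel
  fun_prop

/-- The inner product is half the time derivative of `cos² t ‖y - y'‖² + sin² t ‖T y - T y'‖²`; on
the quarter turn `sin t` and `cos t` are nonnegative. -/
lemma inner_contractionPath_nonpos {T : E → E} (hT : LipschitzWith 1 T) (y y' : E) {t : ℝ}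
    (ht : t ∈ Icc 0 (π / 2)) :
    ⟪contractionPath T y t - contractionPath T y' t,
      contractionVel T y t - contractionVel T y' t⟫_ℝ ≤ 0 := by
  have hs : 0 ≤ sin t := sin_nonneg_of_nonneg_of_le_pi ht.1 (by linarith [ht.2, pi_pos])
  have hc : 0 ≤ cos t := cos_nonneg_of_mem_Icc ⟨by linarith [ht.1, pi_pos], ht.2⟩
  have h1 : ‖T y - T y'‖ ≤ ‖y - y'‖ := by simpa using hT.norm_sub_le y y'
  have h2 : ‖T y - T y'‖ ^ 2 ≤ ‖y - y'‖ ^ 2 := by gcongr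
  have e : ⟪contractionPath T y t - contractionPath T y' t,
      contractionVel T y t - contractionVel T y' t⟫_ℝ
      = sin t * cos t * (‖T y - T y'‖ ^ 2 - ‖y - y'‖ ^ 2) := by
    have e1 : contractionPath T y t - contractionPath T y' t
        = WithLp.toLp 2 (cos t • (y - y'), sin t • (T y - T y')) := by
      simp only [contractionPath, ← WithLp.toLp_smul, ← WithLp.toLp_add, ← WithLp.toLp_sub]
      simp [smul_sub]
    have e2 : contractionVel T y t - contractionVel T y' t
        = WithLp.toLp 2 ((-sin t) • (y - y'), cos t • (T y - T y')) := by
      simp only [contractionVel, ← WithLp.toLp_smul, ← WithLp.toLp_add, ← WithLp.toLp_sub]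
      simp [smul_sub]
    rw [e1, e2, WithLp.prod_inner_apply]
    simp only [real_inner_smul_left, real_inner_smul_right, real_inner_self_eq_norm_sq]
    ring
  rw [e]
  exact mul_nonpos_of_nonneg_of_nonpos (mul_nonneg hs hc) (by linarith)

end Path

/-! ### From finite mixtures and smooth `κ` to general mixtures and superlevel sets -/

section Dominance

variable {E : Type*} [NormedAddCommGroup E] [InnerProductSpace ℝ E] [FiniteDimensional ℝ E]
  [MeasurableSpace E] [BorelSpace E]

lemma lintegral_ofReal_mul_comp_add {X : Type*} [MeasurableSpace X] (ν : Measure X) {G : X → ℝ}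
    (hG : Measurable G) (hG0 : ∀ x, 0 ≤ G x) {κ : ℝ → ℝ} (hκ : Measurable κ) (hκ0 : ∀ r, 0 ≤ κ r)
    (hκ1 : ∀ r, κ r ≤ 1) :
    ∫⁻ x, ENNReal.ofReal (G x * κ (G x)) ∂ν + ∫⁻ x, ENNReal.ofReal (G x * (1 - κ (G x))) ∂ν
      = ∫⁻ x, ENNReal.ofReal (G x) ∂ν := by
  have hm : Measurable fun x => ENNReal.ofReal (G x * κ (G x)) :=
    (hG.mul (hκ.comp hG)).ennreal_ofReal
  rw [← lintegral_add_left hm]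
  refine lintegral_congr fun x => ?_
  rw [← ENNReal.ofReal_add (mul_nonneg (hG0 x) (hκ0 _))
    (mul_nonneg (hG0 x) (sub_nonneg.2 (hκ1 _)))]
  congr 1
  ring

lemma lintegral_gaussMix_mul_comp_le_simpleFunc {b : ℝ} (hb : 0 < b) (μ : Measure E)
    [IsProbabilityMeasure μ] {T : E → E} (hT : LipschitzWith 1 T) (s : SimpleFunc E E) {κ : ℝ → ℝ}
    (hκ : ContDiff ℝ 1 κ) (hmono : Monotone κ) (hk0 : ∀ r, 0 ≤ κ r) (hk1 : ∀ r, κ r ≤ 1) {c : ℝ}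
    (hc : 0 < c) (hκ0 : ∀ r ≤ c, κ r = 0) :
    ∫⁻ x, ENNReal.ofReal (gaussMix b μ (fun y => contractionPath T (s y) 0) x
        * κ (gaussMix b μ (fun y => contractionPath T (s y) 0) x)) ≤
      ∫⁻ x, ENNReal.ofReal (gaussMix b μ (fun y => contractionPath T (s y) (π / 2)) x
        * κ (gaussMix b μ (fun y => contractionPath T (s y) (π / 2)) x)) := by
  have hS : ∀ t, Measurable fun y => contractionPath T (s y) t := fun t =>
    (s.map fun y => contractionPath T y t).measurable
  have hint : ∀ t, Integrable fun x => gaussMix b μ (fun y => contractionPath T (s y) t) x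
        * κ (gaussMix b μ (fun y => contractionPath T (s y) t) x) := by
    intro t
    have hcont := continuous_gaussMix hb.le μ (hS t)
    have h0 : Integrable (gaussMix b μ fun y => contractionPath T (s y) t) := by
      refine (lintegral_ofReal_ne_top_iff_integrable hcont.aestronglyMeasurable
        (Eventually.of_forall fun x => gaussMix_nonneg _ _ _ _)).1 ?_
      rw [lintegral_gaussMix hb.le μ (hS t)]
      exact lintegral_gaussBump_ne_top hb
    refine h0.mono (hcont.mul (hκ.continuous.comp hcont)).aestronglyMeasurable
      (Eventually.of_forall fun x => ?_)
    rw [norm_mul]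
    refine mul_le_of_le_one_right (norm_nonneg _) ?_
    rw [Real.norm_of_nonneg (hk0 _)]
    exact hk1 _
  have hnn : ∀ t x, 0 ≤ gaussMix b μ (fun y => contractionPath T (s y) t) x
        * κ (gaussMix b μ (fun y => contractionPath T (s y) t) x) := fun t x =>
    mul_nonneg (gaussMix_nonneg _ _ _ _) (hk0 _)
  rw [← ofReal_integral_eq_lintegral_ofReal (hint 0) (Eventually.of_forall (hnn 0)),
    ← ofReal_integral_eq_lintegral_ofReal (hint (π / 2)) (Eventually.of_forall (hnn (π / 2)))]
  refine ENNReal.ofReal_le_ofReal ?_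
  have hm := monotoneOn_integral_gaussMixture (μ := (volume : Measure (WithLp 2 (E × E)))) hb
    (p := fun i : s.range => μ.real (s ⁻¹' {i.1})) (fun i => measureReal_nonneg)
    (z := fun i => contractionPath T i.1) (v := fun i => contractionVel T i.1)
    (fun i t => hasDerivAt_contractionPath T i.1 t) (fun i => continuous_contractionVel T i.1)
    (t₀ := 0) (t₁ := π / 2) (fun t ht i j => inner_contractionPath_nonpos hT i.1 j.1 ht) hκ hmono
    hc hκ0
  have h := hm (left_mem_Icc.2 (by positivity)) (right_mem_Icc.2 (by positivity))
    (by positivity : (0 : ℝ) ≤ π / 2)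
  have e : ∀ t, gaussMix b μ (fun y => contractionPath T (s y) t)
      = gaussMixture b (fun i : s.range => μ.real (s ⁻¹' {i.1}))
        (fun i => contractionPath T i.1 t) := fun t =>
    funext (gaussMix_simpleFunc_comp b μ s fun y => contractionPath T y t)
  rw [e, e]
  exact h

/-- Simple functions approximating the identity of `E` give finite mixtures converging pointwise.
Fatou's lemma is useful on the smaller side only, so the larger side is replaced by its complement
in the total mass. -/
lemma lintegral_gaussMix_mul_comp_le {b : ℝ} (hb : 0 < b) (μ : Measure E)
    [IsProbabilityMeasure μ] {T : E → E} (hT : LipschitzWith 1 T) {κ : ℝ → ℝ}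
    (hκ : ContDiff ℝ 1 κ) (hmono : Monotone κ) (hk0 : ∀ r, 0 ≤ κ r) (hk1 : ∀ r, κ r ≤ 1) {c : ℝ}
    (hc : 0 < c) (hκ0 : ∀ r ≤ c, κ r = 0) :
    ∫⁻ x, ENNReal.ofReal (gaussMix b μ (fun y => contractionPath T y 0) x
        * κ (gaussMix b μ (fun y => contractionPath T y 0) x)) ≤
      ∫⁻ x, ENNReal.ofReal (gaussMix b μ (fun y => contractionPath T y (π / 2)) x
        * κ (gaussMix b μ (fun y => contractionPath T y (π / 2)) x)) := by
  have hpath : ∀ t, Continuous fun y => contractionPath T y t := by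
    intro t
    have := hT.continuous
    unfold contractionPath
    fun_prop
  have hid : StronglyMeasurable (id : E → E) := stronglyMeasurable_id
  set s := hid.approx with hs
  have hlim : ∀ t y, Tendsto (fun k => contractionPath T (s k y) t) atTop
      (𝓝 (contractionPath T y t)) := fun t y =>
    ((hpath t).tendsto y).comp (hid.tendsto_approx y)
  have hSk : ∀ k t, Measurable fun y => contractionPath T (s k y) t := fun k t =>
    ((s k).map fun y => contractionPath T y t).measurable
  set F := gaussMix b μ fun y => contractionPath T y 0 with hF
  set G := gaussMix b μ fun y => contractionPath T y (π / 2) with hG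
  set Fk := fun k => gaussMix b μ fun y => contractionPath T (s k y) 0 with hFk
  set Gk := fun k => gaussMix b μ fun y => contractionPath T (s k y) (π / 2) with hGk
  have hGm : Measurable G := (continuous_gaussMix hb.le μ (hpath _).measurable).measurable
  have hFkm : ∀ k, Measurable (Fk k) := fun k =>
    (continuous_gaussMix hb.le μ (hSk k _)).measurable
  have hGkm : ∀ k, Measurable (Gk k) := fun k =>
    (continuous_gaussMix hb.le μ (hSk k _)).measurable
  have hκm := hκ.continuous.measurable
  have hG0 : ∀ x, 0 ≤ G x := fun x => gaussMix_nonneg _ _ _ _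
  have hGk0 : ∀ k x, 0 ≤ Gk k x := fun k x => gaussMix_nonneg _ _ _ _
  have hFkl : ∀ x, Tendsto (fun k => Fk k x) atTop (𝓝 (F x)) :=
    tendsto_gaussMix hb.le μ (hSk · _) (hlim _)
  have hGkl : ∀ x, Tendsto (fun k => Gk k x) atTop (𝓝 (G x)) :=
    tendsto_gaussMix hb.le μ (hSk · _) (hlim _)
  have hmass : ∫⁻ x, ENNReal.ofReal (G x)
      = ∫⁻ x : WithLp 2 (E × E), ENNReal.ofReal (gaussBump b x) :=
    lintegral_gaussMix hb.le μ (hpath _).measurable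
  have hadd := lintegral_ofReal_mul_comp_add volume hGm hG0 hκm hk0 hk1
  have hfin : ∫⁻ x, ENNReal.ofReal (G x * (1 - κ (G x))) ≠ ∞ := by
    refine ne_top_of_le_ne_top (lintegral_gaussBump_ne_top (V := WithLp 2 (E × E)) hb) ?_
    rw [← hmass, ← hadd]
    exact le_add_self
  -- After adding the finite `∫ G (1 - κ(G))`, the right side is the total mass, common to all the
  -- approximations, and Fatou applies to the whole left side.
  refine (ENNReal.add_le_add_iff_right hfin).1 ?_
  rw [hadd, hmass]
  let A : ℕ → WithLp 2 (E × E) → ℝ≥0∞ := fun k x => ENNReal.ofReal (Fk k x * κ (Fk k x))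
    + ENNReal.ofReal (Gk k x * (1 - κ (Gk k x)))
  have hA1 : ∀ k, Measurable fun x => ENNReal.ofReal (Fk k x * κ (Fk k x)) := fun k =>
    ((hFkm k).mul (hκm.comp (hFkm k))).ennreal_ofReal
  have hA2 : ∀ k, Measurable fun x => ENNReal.ofReal (Gk k x * (1 - κ (Gk k x))) := fun k =>
    ((hGkm k).mul (measurable_const.sub (hκm.comp (hGkm k)))).ennreal_ofReal
  have hAl : ∀ x, Tendsto (fun k => A k x) atTop (𝓝 (ENNReal.ofReal (F x * κ (F x))
      + ENNReal.ofReal (G x * (1 - κ (G x))))) := by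
    intro x
    refine (ENNReal.tendsto_ofReal ((hFkl x).mul ((hκ.continuous.tendsto _).comp (hFkl x)))).add
      (ENNReal.tendsto_ofReal ((hGkl x).mul
        (tendsto_const_nhds.sub ((hκ.continuous.tendsto _).comp (hGkl x)))))
  have hAle : ∀ k, ∫⁻ x, A k x ≤ ∫⁻ x : WithLp 2 (E × E), ENNReal.ofReal (gaussBump b x) := by
    intro k
    rw [lintegral_add_left (hA1 k), ← lintegral_gaussMix hb.le μ (hSk k (π / 2)),
      ← lintegral_ofReal_mul_comp_add volume (hGkm k) (hGk0 k) hκm hk0 hk1]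
    refine add_le_add_left ?_ _
    exact lintegral_gaussMix_mul_comp_le_simpleFunc hb μ hT (s k) hκ hmono hk0 hk1 hc hκ0
  have hF1 : Measurable fun x => ENNReal.ofReal (F x * κ (F x)) := by
    have : Measurable F := (continuous_gaussMix hb.le μ (hpath _).measurable).measurable
    exact (this.mul (hκm.comp this)).ennreal_ofReal
  rw [← lintegral_add_left hF1]
  calc ∫⁻ x, (ENNReal.ofReal (F x * κ (F x)) + ENNReal.ofReal (G x * (1 - κ (G x))))
      = ∫⁻ x, liminf (fun k => A k x) atTop := lintegral_congr fun x => (hAl x).liminf_eq.symm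
    _ ≤ liminf (fun k => ∫⁻ x, A k x) atTop := lintegral_liminf_le fun k => (hA1 k).add (hA2 k)
    _ ≤ liminf (fun _ : ℕ => ∫⁻ x : WithLp 2 (E × E), ENNReal.ofReal (gaussBump b x)) atTop :=
        liminf_le_liminf (Eventually.of_forall hAle)
    _ = _ := liminf_const _

/-- The mass of a Gaussian mixture on its superlevel sets increases when the centres are
contracted. -/
lemma lintegral_indicator_gaussMix_le {b : ℝ} (hb : 0 < b) (μ : Measure E)
    [IsProbabilityMeasure μ] {T : E → E} (hT : LipschitzWith 1 T) {c : ℝ} (hc : 0 < c) :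
    ∫⁻ x, ENNReal.ofReal (gaussMix b μ (fun y => contractionPath T y 0) x
        * (Ioi c).indicator 1 (gaussMix b μ (fun y => contractionPath T y 0) x)) ≤
      ∫⁻ x, ENNReal.ofReal (gaussMix b μ (fun y => contractionPath T y (π / 2)) x
        * (Ioi c).indicator 1 (gaussMix b μ (fun y => contractionPath T y (π / 2)) x)) := by
  -- Smooth ramps starting at `c`: they lie below the indicator of `(c, ∞)`, and at each `r > c`
  -- they equal `1` as soon as `m (r - c) ≥ 1`.
  let κ : ℕ → ℝ → ℝ := fun m r => smoothTransition (m * (r - c))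
  have hκd : ∀ m, ContDiff ℝ 1 (κ m) := fun m =>
    (smoothTransition.contDiff (n := 1)).comp (contDiff_const.mul (contDiff_id.sub contDiff_const))
  have hκmono : ∀ m, Monotone (κ m) := fun m r r' h => smoothTransition.monotone (by gcongr)
  have hκz : ∀ m, ∀ r ≤ c, κ m r = 0 := fun m r hr => smoothTransition.zero_of_nonpos
    (mul_nonpos_of_nonneg_of_nonpos (Nat.cast_nonneg m) (sub_nonpos.2 hr))
  have hκle : ∀ m r, κ m r ≤ (Ioi c).indicator 1 r := by
    intro m r
    by_cases hr : c < r
    · rw [indicator_of_mem (mem_Ioi.2 hr)]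
      exact smoothTransition.le_one _
    · rw [indicator_of_notMem (by simpa using hr), hκz m r (not_lt.1 hr)]
  have hκl : ∀ r, Tendsto (fun m => κ m r) atTop (𝓝 ((Ioi c).indicator 1 r)) := by
    intro r
    refine tendsto_const_nhds.congr' ?_
    by_cases hr : c < r
    · rw [indicator_of_mem (mem_Ioi.2 hr)]
      have h : Tendsto (fun m : ℕ => (m : ℝ) * (r - c)) atTop atTop :=
        tendsto_natCast_atTop_atTop.atTop_mul_const (sub_pos.2 hr)
      filter_upwards [h.eventually_ge_atTop 1] with m hm
      exact (smoothTransition.one_of_one_le hm).symm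
    · rw [indicator_of_notMem (by simpa using hr)]
      exact Eventually.of_forall fun m => (hκz m r (not_lt.1 hr)).symm
  set F := gaussMix b μ fun y => contractionPath T y 0 with hF
  set G := gaussMix b μ fun y => contractionPath T y (π / 2) with hG
  have hFm : Measurable F := by
    refine (continuous_gaussMix hb.le μ (Continuous.measurable ?_)).measurable
    have := hT.continuous
    unfold contractionPath
    fun_prop
  calc ∫⁻ x, ENNReal.ofReal (F x * (Ioi c).indicator 1 (F x))
      = ∫⁻ x, liminf (fun m => ENNReal.ofReal (F x * κ m (F x))) atTop :=
        lintegral_congr fun x => (ENNReal.tendsto_ofReal ((hκl _).const_mul _)).liminf_eq.symm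
    _ ≤ liminf (fun m => ∫⁻ x, ENNReal.ofReal (F x * κ m (F x))) atTop :=
        lintegral_liminf_le fun m =>
          (hFm.mul ((hκd m).continuous.measurable.comp hFm)).ennreal_ofReal
    _ ≤ liminf (fun _ : ℕ => ∫⁻ x, ENNReal.ofReal (G x * (Ioi c).indicator 1 (G x))) atTop := by
        refine liminf_le_liminf (Eventually.of_forall fun m => ?_)
        refine (lintegral_gaussMix_mul_comp_le hb μ hT (hκd m) (hκmono m)
          (fun _ => smoothTransition.nonneg _) (fun _ => smoothTransition.le_one _) hc
          (hκz m)).trans (lintegral_mono fun x => ENNReal.ofReal_le_ofReal ?_)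
        exact mul_le_mul_of_nonneg_left (hκle m _) (gaussMix_nonneg _ _ _ _)
    _ = _ := liminf_const _

end Dominance

/-! ### Stochastic order on the line and integrals of monotone functions -/

section Stochastic

/-- An upper set of `ℝ` is empty, the whole line, or an open or closed half-line; a closed half-line
is a decreasing intersection of open ones. -/
lemma measure_le_of_isUpperSet {ν₁ ν₂ : Measure ℝ} [IsProbabilityMeasure ν₁]
    [IsProbabilityMeasure ν₂] (h : ∀ c, ν₁ (Ioi c) ≤ ν₂ (Ioi c)) {U : Set ℝ} (hU : IsUpperSet U) :
    ν₁ U ≤ ν₂ U := by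
  rcases U.eq_empty_or_nonempty with rfl | hne
  · simp
  by_cases hb : BddBelow U
  · have hIoi : Ioi (sInf U) ⊆ U := fun x hx => by
      obtain ⟨y, hy, hyx⟩ := exists_lt_of_csInf_lt hne hx
      exact hU hyx.le hy
    by_cases hc : sInf U ∈ U
    · have hUe : U = ⋂ n : ℕ, Ioi (sInf U - 1 / ((n : ℝ) + 1)) := by
        ext x
        simp only [mem_iInter, mem_Ioi]
        refine ⟨fun hx n => ?_, fun hx => hU ?_ hc⟩
        · have h1 := csInf_le hb hx
          have h2 : 0 < 1 / ((n : ℝ) + 1) := by positivity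
          linarith
        · have h1 : Tendsto (fun n : ℕ => sInf U - 1 / ((n : ℝ) + 1)) atTop (𝓝 (sInf U - 0)) :=
            tendsto_const_nhds.sub tendsto_one_div_add_atTop_nhds_zero_nat
          rw [sub_zero] at h1
          exact le_of_tendsto' h1 fun n => (hx n).le
      have hanti : Antitone fun n : ℕ => Ioi (sInf U - 1 / ((n : ℝ) + 1)) := fun m n hmn =>
        Ioi_subset_Ioi (sub_le_sub_left (Nat.one_div_le_one_div hmn) _)
      have key : ∀ ν : Measure ℝ, [IsProbabilityMeasure ν] →
          Tendsto (fun n : ℕ => ν (Ioi (sInf U - 1 / ((n : ℝ) + 1)))) atTop (𝓝 (ν U)) := by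
        intro ν _
        have := tendsto_measure_iInter_atTop (μ := ν)
          (fun n : ℕ => (measurableSet_Ioi (a := sInf U - 1 / ((n : ℝ) + 1))).nullMeasurableSet)
          hanti ⟨0, measure_ne_top _ _⟩
        rwa [← hUe] at this
      exact le_of_tendsto_of_tendsto' (key ν₁) (key ν₂) fun n => h _
    · have hUe : U = Ioi (sInf U) := subset_antisymm
        (fun x hx => lt_of_le_of_ne (csInf_le hb hx) fun hx' => hc (hx' ▸ hx)) hIoi
      rw [hUe]
      exact h _
  · have hUe : U = univ := eq_univ_of_forall fun x => by
      obtain ⟨y, hy, hyx⟩ := not_bddBelow_iff.1 hb x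
      exact hU hyx.le hy
    rw [hUe, measure_univ, measure_univ]

lemma measure_le_of_isLowerSet {ν₁ ν₂ : Measure ℝ} [IsProbabilityMeasure ν₁]
    [IsProbabilityMeasure ν₂] (h : ∀ c, ν₁ (Ioi c) ≤ ν₂ (Ioi c)) {U : Set ℝ} (hU : IsLowerSet U) :
    ν₂ U ≤ ν₁ U := by
  have hm : MeasurableSet U := hU.ordConnected.measurableSet
  have h1 := measure_le_of_isUpperSet h hU.compl
  rw [prob_compl_eq_one_sub hm, prob_compl_eq_one_sub hm] at h1
  calc ν₂ U = 1 - (1 - ν₂ U) := (ENNReal.sub_sub_cancel (by simp) prob_le_one).symm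
    _ ≤ 1 - (1 - ν₁ U) := tsub_le_tsub_left h1 _
    _ = ν₁ U := ENNReal.sub_sub_cancel (by simp) prob_le_one

/-- The layer-cake formula, applied to the real-valued truncations `min k n`; Fatou's lemma then
removes the truncation. -/
lemma lintegral_le_of_measure_lt_le {X : Type*} [MeasurableSpace X] {ν₁ ν₂ : Measure X}
    {k : X → ℝ≥0∞} (hk : Measurable k) (h : ∀ t, ν₁ {x | t < k x} ≤ ν₂ {x | t < k x}) :
    ∫⁻ x, k x ∂ν₁ ≤ ∫⁻ x, k x ∂ν₂ := by
  have hne : ∀ n : ℕ, ∀ x, min (k x) (n : ℝ≥0∞) ≠ ∞ := fun n x =>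
    ne_top_of_le_ne_top (ENNReal.natCast_ne_top n) (min_le_right _ _)
  have hmin : ∀ n : ℕ, ∀ x, min (k x) n = ENNReal.ofReal (min (k x) n).toReal := fun n x =>
    (ENNReal.ofReal_toReal (hne n x)).symm
  have hkm : ∀ n : ℕ, Measurable fun x => min (k x) (n : ℝ≥0∞) := fun n =>
    hk.min measurable_const
  have key : ∀ n : ℕ, ∫⁻ x, min (k x) n ∂ν₁ ≤ ∫⁻ x, min (k x) n ∂ν₂ := by
    intro n
    rw [lintegral_congr (hmin n), lintegral_congr (hmin n),
      lintegral_eq_lintegral_meas_lt _ (Eventually.of_forall fun _ => ENNReal.toReal_nonneg)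
        (hkm n).ennreal_toReal.aemeasurable,
      lintegral_eq_lintegral_meas_lt _ (Eventually.of_forall fun _ => ENNReal.toReal_nonneg)
        (hkm n).ennreal_toReal.aemeasurable]
    refine setLIntegral_mono' measurableSet_Ioi fun t (ht : 0 < t) => ?_
    have hset : ∀ x, t < (min (k x) (n : ℝ≥0∞)).toReal ↔ ENNReal.ofReal t < k x ∧ t < n := by
      intro x
      rw [← ENNReal.ofReal_lt_iff_lt_toReal ht.le (hne n x), lt_min_iff,
        ENNReal.ofReal_lt_iff_lt_toReal ht.le (ENNReal.natCast_ne_top n), ENNReal.toReal_natCast]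
    simp_rw [hset]
    by_cases htn : t < n
    · simpa only [htn, and_true] using h _
    · simp only [htn, and_false, ofPred_false, measure_empty, le_refl]
  calc ∫⁻ x, k x ∂ν₁ = ∫⁻ x, liminf (fun n : ℕ => min (k x) n) atTop ∂ν₁ := by
        refine lintegral_congr fun x => (Tendsto.liminf_eq ?_).symm
        simpa using (tendsto_const_nhds (x := k x)).min ENNReal.tendsto_nat_nhds_top
    _ ≤ liminf (fun n : ℕ => ∫⁻ x, min (k x) n ∂ν₁) atTop := lintegral_liminf_le hkm
    _ ≤ liminf (fun _ : ℕ => ∫⁻ x, k x ∂ν₂) atTop :=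
        liminf_le_liminf (Eventually.of_forall fun n =>
          (key n).trans (lintegral_mono fun _ => min_le_left _ _))
    _ = _ := liminf_const _

lemma lintegral_le_of_monotone {ν₁ ν₂ : Measure ℝ} [IsProbabilityMeasure ν₁]
    [IsProbabilityMeasure ν₂] (h : ∀ c, ν₁ (Ioi c) ≤ ν₂ (Ioi c)) {k : ℝ → ℝ≥0∞}
    (hk : Monotone k) : ∫⁻ x, k x ∂ν₁ ≤ ∫⁻ x, k x ∂ν₂ :=
  lintegral_le_of_measure_lt_le hk.measurable fun _ =>
    measure_le_of_isUpperSet h fun _ _ hab ha => lt_of_lt_of_le ha (hk hab)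

lemma lintegral_le_of_antitone {ν₁ ν₂ : Measure ℝ} [IsProbabilityMeasure ν₁]
    [IsProbabilityMeasure ν₂] (h : ∀ c, ν₁ (Ioi c) ≤ ν₂ (Ioi c)) {k : ℝ → ℝ≥0∞}
    (hk : Antitone k) : ∫⁻ x, k x ∂ν₂ ≤ ∫⁻ x, k x ∂ν₁ :=
  lintegral_le_of_measure_lt_le hk.measurable fun _ =>
    measure_le_of_isLowerSet h fun _ _ hab ha => lt_of_lt_of_le ha (hk hab)

/-- The law of `F` under the measure with density `F` with respect to `ν`. -/
noncomputable def densityLaw {X : Type*} [MeasurableSpace X] (ν : Measure X) (F : X → ℝ) :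
    Measure ℝ :=
  (ν.withDensity fun x => ENNReal.ofReal (F x)).map F

lemma lintegral_densityLaw {X : Type*} [MeasurableSpace X] (ν : Measure X) {F : X → ℝ}
    (hF : Measurable F) {k : ℝ → ℝ≥0∞} (hk : Measurable k) :
    ∫⁻ r, k r ∂densityLaw ν F = ∫⁻ x, ENNReal.ofReal (F x) * k (F x) ∂ν := by
  rw [densityLaw, lintegral_map hk hF]
  exact lintegral_withDensity_eq_lintegral_mul _ hF.ennreal_ofReal (hk.comp hF)

lemma densityLaw_Ioi {X : Type*} [MeasurableSpace X] (ν : Measure X) {F : X → ℝ}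
    (hF : Measurable F) (c : ℝ) :
    densityLaw ν F (Ioi c) = ∫⁻ x, ENNReal.ofReal (F x * (Ioi c).indicator 1 (F x)) ∂ν := by
  rw [← lintegral_indicator_one measurableSet_Ioi, lintegral_densityLaw ν hF
    (measurable_one.indicator measurableSet_Ioi)]
  refine lintegral_congr fun x => ?_
  by_cases h : c < F x <;> simp [indicator, h]

lemma isProbabilityMeasure_densityLaw {X : Type*} [MeasurableSpace X] {ν : Measure X} {F : X → ℝ}
    (hF : Measurable F) (h : ∫⁻ x, ENNReal.ofReal (F x) ∂ν = 1) :
    IsProbabilityMeasure (densityLaw ν F) := by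
  refine ⟨?_⟩
  rw [densityLaw, Measure.map_apply hF MeasurableSet.univ]
  simpa using h

end Stochastic

/-! ### The endpoints of the motion as product densities -/

section Product

variable {E : Type*} [NormedAddCommGroup E] [InnerProductSpace ℝ E] [FiniteDimensional ℝ E]
  [MeasurableSpace E] [BorelSpace E]

omit [InnerProductSpace ℝ E] [FiniteDimensional ℝ E] [MeasurableSpace E] [BorelSpace E] in
lemma gaussBump_toLp (b : ℝ) (q : E × E) :
    gaussBump b (WithLp.toLp 2 q) = gaussBump b q.1 * gaussBump b q.2 := by
  rw [gaussBump, gaussBump, gaussBump, ← Real.exp_add, WithLp.prod_norm_sq_eq_of_L2]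
  change rexp (-b * (‖q.1‖ ^ 2 + ‖q.2‖ ^ 2)) = _
  rw [mul_add]

omit [FiniteDimensional ℝ E] [BorelSpace E] in
-- All centres are `(y, 0)`, so the bump splits over the coordinates and its second factor comes out
-- of the integral.
lemma gaussMix_contractionPath_zero (b : ℝ) (μ : Measure E) (T : E → E) (q : E × E) :
    gaussMix b μ (fun y => contractionPath T y 0) (WithLp.toLp 2 q)
      = gaussMix b μ id q.1 * gaussBump b q.2 := by
  rw [gaussMix, gaussMix, ← integral_mul_const]
  refine integral_congr_ae (Eventually.of_forall fun y => ?_)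
  simp [contractionPath, ← WithLp.toLp_sub, gaussBump_toLp]

omit [FiniteDimensional ℝ E] [BorelSpace E] in
lemma gaussMix_contractionPath_pi_div_two (b : ℝ) (μ : Measure E) (T : E → E) (q : E × E) :
    gaussMix b μ (fun y => contractionPath T y (π / 2)) (WithLp.toLp 2 q)
      = gaussMix b μ T q.2 * gaussBump b q.1 := by
  rw [gaussMix, gaussMix, ← integral_mul_const]
  refine integral_congr_ae (Eventually.of_forall fun y => ?_)
  simp [contractionPath, ← WithLp.toLp_sub, gaussBump_toLp, mul_comm]

/-- The mass of the product of a Gaussian mixture and a Gaussian on its superlevel sets increases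
when the centres of the mixture are contracted. -/
theorem densityLaw_gaussMix_mul_gaussBump_Ioi_le {b : ℝ} (hb : 0 < b) (μ : Measure E)
    [IsProbabilityMeasure μ] {T : E → E} (hT : LipschitzWith 1 T) {C : ℝ} (hC : 0 < C) (c : ℝ) :
    densityLaw (volume : Measure (E × E))
        (fun q => (C * gaussMix b μ id q.1) * (C * gaussBump b q.2)) (Ioi c) ≤
      densityLaw (volume : Measure (E × E))
        (fun q => (C * gaussMix b μ T q.1) * (C * gaussBump b q.2)) (Ioi c) := by
  have hpath : ∀ t, Continuous fun y => contractionPath T y t := by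
    intro t
    have := hT.continuous
    unfold contractionPath
    fun_prop
  set F := gaussMix b μ fun y => contractionPath T y 0 with hF
  set G := gaussMix b μ fun y => contractionPath T y (π / 2) with hG
  have hFm : Measurable F := (continuous_gaussMix hb.le μ (hpath _).measurable).measurable
  have hGm : Measurable G := (continuous_gaussMix hb.le μ (hpath _).measurable).measurable
  have h0 : ∀ d : ℝ, ∫⁻ x, ENNReal.ofReal (F x * (Ioi d).indicator 1 (F x))
      ≤ ∫⁻ x, ENNReal.ofReal (G x * (Ioi d).indicator 1 (G x)) := by
    intro d
    rcases lt_or_ge 0 d with hd | hd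
    · exact lintegral_indicator_gaussMix_le hb μ hT hd
    -- Mixtures are positive, so at a level `d ≤ 0` both sides are the full mass.
    · have hFd : ∀ x, (Ioi d).indicator (1 : ℝ → ℝ) (F x) = 1 := fun x => by
        rw [indicator_of_mem, Pi.one_apply]
        exact hd.trans_lt (gaussMix_pos hb.le μ (hpath _).measurable x)
      have hGd : ∀ x, (Ioi d).indicator (1 : ℝ → ℝ) (G x) = 1 := fun x => by
        rw [indicator_of_mem, Pi.one_apply]
        exact hd.trans_lt (gaussMix_pos hb.le μ (hpath _).measurable x)
      simp_rw [hFd, hGd, mul_one]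
      rw [hF, hG, lintegral_gaussMix hb.le μ (hpath _).measurable,
        lintegral_gaussMix hb.le μ (hpath _).measurable]
  have hind : ∀ d : ℝ, Measurable fun r : ℝ => ENNReal.ofReal (r * (Ioi d).indicator 1 r) :=
    fun d => (measurable_id.mul (measurable_one.indicator measurableSet_Ioi)).ennreal_ofReal
  have hindF : ∀ d, Measurable fun x => ENNReal.ofReal (F x * (Ioi d).indicator 1 (F x)) :=
    fun d => (hind d).comp hFm
  have hindG : ∀ d, Measurable fun x => ENNReal.ofReal (G x * (Ioi d).indicator 1 (G x)) :=
    fun d => (hind d).comp hGm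
  -- The two normalising constants only move the level from `c` to `c / (C * C)`.
  have hscale : ∀ r : ℝ, ENNReal.ofReal (C * C * r * (Ioi c).indicator 1 (C * C * r))
      = ENNReal.ofReal (C * C) * ENNReal.ofReal (r * (Ioi (c / (C * C))).indicator 1 r) := by
    intro r
    rw [← ENNReal.ofReal_mul (by positivity)]
    congr 1
    have : c / (C * C) < r ↔ c < C * C * r := by
      rw [div_lt_iff₀ (by positivity), mul_comm]
    by_cases hr : c < C * C * r
    · simp [indicator, hr, this]
    · simp [indicator, hr, this]
  have hm1 : Measurable fun q : E × E => (C * gaussMix b μ id q.1) * (C * gaussBump b q.2) :=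
    (((continuous_gaussMix hb.le μ measurable_id).measurable.comp measurable_fst).const_mul C).mul
      (((measurable_gaussBump b).comp measurable_snd).const_mul C)
  have hm2 : Measurable fun q : E × E => (C * gaussMix b μ T q.1) * (C * gaussBump b q.2) :=
    (((continuous_gaussMix hb.le μ hT.continuous.measurable).measurable.comp
      measurable_fst).const_mul C).mul (((measurable_gaussBump b).comp measurable_snd).const_mul C)
  rw [densityLaw_Ioi _ hm1, densityLaw_Ioi _ hm2]
  have e1 : ∫⁻ q : E × E, ENNReal.ofReal ((C * gaussMix b μ id q.1) * (C * gaussBump b q.2)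
        * (Ioi c).indicator 1 ((C * gaussMix b μ id q.1) * (C * gaussBump b q.2)))
      = ∫⁻ x, ENNReal.ofReal (C * C * F x * (Ioi c).indicator 1 (C * C * F x)) := by
    simp_rw [hscale]
    rw [← (WithLp.volume_preserving_toLp E E).lintegral_comp
      ((hindF _).const_mul _)]
    refine lintegral_congr fun q => ?_
    rw [← hscale, hF, gaussMix_contractionPath_zero, mul_mul_mul_comm]
  -- At time `π / 2` the mixture sits in the second coordinate; the swap brings it back to the
  -- first.
  have hswap : MeasurePreserving (Prod.swap : E × E → E × E) volume volume :=
    Measure.measurePreserving_swap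
  have e2 : ∫⁻ q : E × E, ENNReal.ofReal ((C * gaussMix b μ T q.1) * (C * gaussBump b q.2)
        * (Ioi c).indicator 1 ((C * gaussMix b μ T q.1) * (C * gaussBump b q.2)))
      = ∫⁻ x, ENNReal.ofReal (C * C * G x * (Ioi c).indicator 1 (C * C * G x)) := by
    have hm : Measurable fun a : E × E => ENNReal.ofReal (C * C) * ENNReal.ofReal
        (G (WithLp.toLp 2 a) * (Ioi (c / (C * C))).indicator 1 (G (WithLp.toLp 2 a))) :=
      ((hindG _).const_mul _).comp (WithLp.volume_preserving_toLp E E).measurable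
    simp_rw [hscale]
    rw [← (WithLp.volume_preserving_toLp E E).lintegral_comp
      ((hindG _).const_mul _),
      ← hswap.lintegral_comp hm]
    refine lintegral_congr fun q => ?_
    rw [← hscale, hG, gaussMix_contractionPath_pi_div_two, mul_mul_mul_comm]
    rfl
  rw [e1, e2]
  simp_rw [hscale]
  rw [lintegral_const_mul _ (hindF _), lintegral_const_mul _ (hindG _)]
  exact mul_le_mul' le_rfl (h0 _)

end Product

/-! ### Shannon entropy of bounded densities -/

section Entropy

variable {E : Type*} [MeasureSpace E] [TopologicalSpace E]

/-- `f` is a continuous positive probability density bounded by `M ≥ 1`. -/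
structure IsBoundedDensity (f : E → ℝ) (M : ℝ) : Prop where
  continuous : Continuous f
  pos : ∀ x, 0 < f x
  le : ∀ x, f x ≤ M
  one_le : 1 ≤ M
  lintegral_eq_one : ∫⁻ x, ENNReal.ofReal (f x) = 1

/-- The entropy integral `∫ f log (M / f)`, whose integrand is nonnegative if `f ≤ M`. -/
noncomputable def entropyDeficit (f : E → ℝ) (M : ℝ) : ℝ≥0∞ :=
  ∫⁻ x, ENNReal.ofReal (f x) * ENNReal.ofReal (log M - log (f x))

variable [OpensMeasurableSpace E] {f g γ : E → ℝ} {M : ℝ}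

lemma IsBoundedDensity.measurable (hf : IsBoundedDensity f M) : Measurable f :=
  hf.continuous.measurable

omit [OpensMeasurableSpace E] in
lemma IsBoundedDensity.log_le (hf : IsBoundedDensity f M) (x : E) : log (f x) ≤ log M :=
  log_le_log (hf.pos x) (hf.le x)

/-- Since `f log f ≤ f log M` and `f` has mass one, the negative part is at most `log M`. This is
what makes `h_1` exist. -/
lemma IsBoundedDensity.shannonNeg_ne_top (hf : IsBoundedDensity f M) :
    shannonNeg (fun x => ENNReal.ofReal (f x)) ≠ ∞ := by
  have hle : shannonNeg (fun x => ENNReal.ofReal (f x))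
      ≤ ∫⁻ x, ENNReal.ofReal (f x) * ENNReal.ofReal (log M) := by
    refine lintegral_mono fun x => ?_
    rw [ENNReal.toReal_ofReal (hf.pos x).le, ← ENNReal.ofReal_mul (hf.pos x).le]
    refine ENNReal.ofReal_le_ofReal ?_
    rw [negMulLog]
    have := mul_le_mul_of_nonneg_left (hf.log_le x) (hf.pos x).le
    linarith
  refine ne_top_of_le_ne_top ?_ hle
  rw [lintegral_mul_const _ hf.measurable.ennreal_ofReal, hf.lintegral_eq_one]
  simp

/-- This is `∫ f log (M / f) = h_1(f) + log M`, arranged without subtraction so that it remains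
valid when terms are infinite. -/
lemma IsBoundedDensity.entropyDeficit_add_shannonNeg (hf : IsBoundedDensity f M) :
    entropyDeficit f M + shannonNeg (fun x => ENNReal.ofReal (f x))
      = shannonPos (fun x => ENNReal.ofReal (f x)) + ENNReal.ofReal (log M) := by
  have hm := hf.measurable
  have h1 : ENNReal.ofReal (log M) = ∫⁻ x, ENNReal.ofReal (f x) * ENNReal.ofReal (log M) := by
    rw [lintegral_mul_const _ hm.ennreal_ofReal, hf.lintegral_eq_one, one_mul]
  have hlm : Measurable fun x => log M - log (f x) := by fun_prop
  rw [h1, entropyDeficit, shannonNeg, shannonPos, ← lintegral_add_left, ← lintegral_add_left]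
  · refine lintegral_congr fun x => ?_
    have hx := hf.pos x
    have hlog := hf.log_le x
    have hM := log_nonneg hf.one_le
    rw [ENNReal.toReal_ofReal hx.le, ← ENNReal.ofReal_mul hx.le, ← ENNReal.ofReal_mul hx.le,
      negMulLog]
    rcases le_total 0 (log (f x)) with h | h
    · have h2 : 0 ≤ f x * log (f x) := mul_nonneg hx.le h
      rw [ENNReal.ofReal_of_nonpos (p := -f x * log (f x)) (by linarith), zero_add,
        ← ENNReal.ofReal_add (mul_nonneg hx.le (by linarith)) (by linarith)]
      congr 1
      ring
    · have h2 : f x * log (f x) ≤ 0 := mul_nonpos_of_nonneg_of_nonpos hx.le h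
      rw [ENNReal.ofReal_of_nonpos (p := -(-f x * log (f x))) (by linarith), add_zero,
        ← ENNReal.ofReal_add (by linarith) (mul_nonneg hx.le hM)]
      congr 1
      ring
  · have : Measurable fun x => negMulLog (f x) :=
      continuous_negMulLog.measurable.comp hm
    simp_rw [ENNReal.toReal_ofReal (hf.pos _).le]
    exact this.ennreal_ofReal
  · exact hm.ennreal_ofReal.mul hlm.ennreal_ofReal

lemma IsBoundedDensity.shannon_le (hf : IsBoundedDensity f M) (hg : IsBoundedDensity g M)
    (h : entropyDeficit g M ≤ entropyDeficit f M) :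
    (shannonPos (fun x => ENNReal.ofReal (g x)) : EReal)
        - (shannonNeg (fun x => ENNReal.ofReal (g x)) : EReal) ≤
      (shannonPos (fun x => ENNReal.ofReal (f x)) : EReal)
        - (shannonNeg (fun x => ENNReal.ofReal (f x)) : EReal) := by
  have hf1 := hf.entropyDeficit_add_shannonNeg
  have hg1 := hg.entropyDeficit_add_shannonNeg
  have hf2 := hf.shannonNeg_ne_top
  have hg2 := hg.shannonNeg_ne_top
  generalize shannonPos (fun x => ENNReal.ofReal (f x)) = pf at *
  generalize shannonPos (fun x => ENNReal.ofReal (g x)) = pg at *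
  generalize shannonNeg (fun x => ENNReal.ofReal (f x)) = nf at *
  generalize shannonNeg (fun x => ENNReal.ofReal (g x)) = ng at *
  generalize entropyDeficit f M = ef at *
  generalize entropyDeficit g M = eg at *
  lift nf to NNReal using hf2
  lift ng to NNReal using hg2
  -- An infinite positive part for `f` makes the right side `⊤`; otherwise every quantity is finite
  -- and the claim is real arithmetic.
  by_cases hpf : pf = ∞
  · subst hpf
    have : (((⊤ : ℝ≥0∞) : EReal) - ((nf : ℝ≥0∞) : EReal)) = ⊤ := by
      rw [EReal.coe_ennreal_top]
      exact EReal.top_sub_coe (nf : ℝ)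
    rw [this]
    exact le_top
  have hef : ef ≠ ∞ := by
    rintro rfl
    rw [top_add] at hf1
    exact ENNReal.add_ne_top.2 ⟨hpf, ENNReal.ofReal_ne_top⟩ hf1.symm
  have heg : eg ≠ ∞ := ne_top_of_le_ne_top hef h
  have hpg : pg ≠ ∞ := by
    rintro rfl
    rw [top_add] at hg1
    exact ENNReal.add_ne_top.2 ⟨heg, ENNReal.coe_ne_top⟩ hg1
  lift pf to NNReal using hpf
  lift pg to NNReal using hpg
  lift ef to NNReal using hef
  lift eg to NNReal using heg
  rw [ENNReal.ofReal] at hf1 hg1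
  norm_cast at hf1 hg1 h
  have hf1' := congrArg NNReal.toReal hf1
  have hg1' := congrArg NNReal.toReal hg1
  have h' : (eg : ℝ) ≤ ef := h
  push_cast at hf1' hg1'
  change (((pg : ℝ) : EReal) - ((ng : ℝ) : EReal)) ≤ (((pf : ℝ) : EReal) - ((nf : ℝ) : EReal))
  rw [← EReal.coe_sub, ← EReal.coe_sub, EReal.coe_le_coe_iff]
  linarith

end Entropy

/-! ### Entropy comparison from domination of the products with `γ` -/

section Comparison

variable {E : Type*} [MeasureSpace E] [TopologicalSpace E] [OpensMeasurableSpace E]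
  [SigmaFinite (volume : Measure E)] {f g γ : E → ℝ} {M : ℝ}

omit [SigmaFinite (volume : Measure E)] in
lemma IsBoundedDensity.measurable_prod (hf : IsBoundedDensity f M) (hγ : IsBoundedDensity γ M) :
    Measurable fun q : E × E => f q.1 * γ q.2 :=
  (hf.measurable.comp measurable_fst).mul (hγ.measurable.comp measurable_snd)

omit [TopologicalSpace E] [OpensMeasurableSpace E] in
lemma lintegral_prod_mul_volume {φ ψ : E → ℝ≥0∞} (hφ : Measurable φ) (hψ : Measurable ψ) :
    ∫⁻ q : E × E, φ q.1 * ψ q.2 = (∫⁻ x, φ x) * ∫⁻ x, ψ x := by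
  rw [Measure.volume_eq_prod, lintegral_prod_mul hφ.aemeasurable hψ.aemeasurable]

lemma IsBoundedDensity.isProbabilityMeasure_prod (hf : IsBoundedDensity f M)
    (hγ : IsBoundedDensity γ M) :
    IsProbabilityMeasure (densityLaw (volume : Measure (E × E)) fun q => f q.1 * γ q.2) := by
  refine isProbabilityMeasure_densityLaw (hf.measurable_prod hγ) ?_
  simp_rw [ENNReal.ofReal_mul (hf.pos _).le]
  rw [lintegral_prod_mul_volume hf.measurable.ennreal_ofReal hγ.measurable.ennreal_ofReal,
    hf.lintegral_eq_one, hγ.lintegral_eq_one, one_mul]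

/-- Sampling under the density itself supplies one factor, hence the exponent `p - 1`; the `p`-th
power of a product then integrates to a product. -/
lemma IsBoundedDensity.lintegral_rpow_prod (hf : IsBoundedDensity f M)
    (hγ : IsBoundedDensity γ M) (p : ℝ)
    (hk : Measurable fun r : ℝ => ENNReal.ofReal r ^ (p - 1)) :
    ∫⁻ r, ENNReal.ofReal r ^ (p - 1)
        ∂densityLaw (volume : Measure (E × E)) (fun q => f q.1 * γ q.2)
      = (∫⁻ x, ENNReal.ofReal (f x) ^ p) * ∫⁻ x, ENNReal.ofReal (γ x) ^ p := by
  rw [lintegral_densityLaw _ (hf.measurable_prod hγ) hk, ← lintegral_prod_mul_volume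
    (hf.measurable.ennreal_ofReal.pow_const p) (hγ.measurable.ennreal_ofReal.pow_const p)]
  refine lintegral_congr fun q => ?_
  have h0 : 0 < f q.1 * γ q.2 := mul_pos (hf.pos _) (hγ.pos _)
  have e : ENNReal.ofReal (f q.1 * γ q.2) * ENNReal.ofReal (f q.1 * γ q.2) ^ (p - 1)
      = ENNReal.ofReal (f q.1 * γ q.2) ^ p := by
    conv_lhs => rw [← ENNReal.rpow_one (ENNReal.ofReal (f q.1 * γ q.2)), ← ENNReal.rpow_mul,
      ← ENNReal.rpow_add _ _ (by simpa using h0) ENNReal.ofReal_ne_top]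
    congr 1
    ring
  rw [e, ENNReal.ofReal_mul (hf.pos _).le,
    ENNReal.mul_rpow_of_ne_top ENNReal.ofReal_ne_top ENNReal.ofReal_ne_top]

lemma antitone_ofReal_rpow {p : ℝ} (hp : p ≤ 0) : Antitone fun r : ℝ => ENNReal.ofReal r ^ p := by
  intro r r' h
  have h1 : ENNReal.ofReal r ^ (-p) ≤ ENNReal.ofReal r' ^ (-p) :=
    ENNReal.rpow_le_rpow (ENNReal.ofReal_le_ofReal h) (by linarith)
  rw [ENNReal.rpow_neg, ENNReal.rpow_neg] at h1
  exact ENNReal.inv_le_inv.1 h1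

lemma monotone_ofReal_rpow {p : ℝ} (hp : 0 ≤ p) : Monotone fun r : ℝ => ENNReal.ofReal r ^ p :=
  fun _ _ h => ENNReal.rpow_le_rpow (ENNReal.ofReal_le_ofReal h) hp

omit [SigmaFinite (volume : Measure E)] in
lemma IsBoundedDensity.lintegral_rpow_ne_zero [NeZero (volume : Measure E)]
    (hγ : IsBoundedDensity γ M) (p : ℝ) : ∫⁻ x, ENNReal.ofReal (γ x) ^ p ≠ 0 := by
  rw [← pos_iff_ne_zero, lintegral_pos_iff_support (hγ.measurable.ennreal_ofReal.pow_const p)]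
  have : Function.support (fun x => ENNReal.ofReal (γ x) ^ p) = univ :=
    eq_univ_of_forall fun x =>
      (ENNReal.rpow_pos (ENNReal.ofReal_pos.2 (hγ.pos x)) ENNReal.ofReal_ne_top).ne'
  rw [this]
  exact pos_iff_ne_zero.2 (by simpa using NeZero.ne (volume : Measure E))

variable [NeZero (volume : Measure E)]

/-- Here `r ^ (p - 1)` is increasing, and the common factor `∫ γ ^ p`, finite and nonzero, cancels.
-/
lemma IsBoundedDensity.lintegral_rpow_le_of_one_le (hf : IsBoundedDensity f M)
    (hg : IsBoundedDensity g M) (hγ : IsBoundedDensity γ M)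
    (h : ∀ c, densityLaw (volume : Measure (E × E)) (fun q => f q.1 * γ q.2) (Ioi c)
      ≤ densityLaw (volume : Measure (E × E)) (fun q => g q.1 * γ q.2) (Ioi c))
    {p : ℝ} (hp : 1 ≤ p) (hγp : ∫⁻ x, ENNReal.ofReal (γ x) ^ p ≠ ∞) :
    ∫⁻ x, ENNReal.ofReal (f x) ^ p ≤ ∫⁻ x, ENNReal.ofReal (g x) ^ p := by
  have := hf.isProbabilityMeasure_prod hγ
  have := hg.isProbabilityMeasure_prod hγ
  have hk := monotone_ofReal_rpow (p := p - 1) (by linarith)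
  have key := lintegral_le_of_monotone h hk
  rw [hf.lintegral_rpow_prod hγ p hk.measurable, hg.lintegral_rpow_prod hγ p hk.measurable] at key
  exact (ENNReal.mul_le_mul_iff_left (hγ.lintegral_rpow_ne_zero p) hγp).1 key

lemma IsBoundedDensity.lintegral_rpow_le_of_le_one (hf : IsBoundedDensity f M)
    (hg : IsBoundedDensity g M) (hγ : IsBoundedDensity γ M)
    (h : ∀ c, densityLaw (volume : Measure (E × E)) (fun q => f q.1 * γ q.2) (Ioi c)
      ≤ densityLaw (volume : Measure (E × E)) (fun q => g q.1 * γ q.2) (Ioi c))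
    {p : ℝ} (hp : p ≤ 1) (hγp : ∫⁻ x, ENNReal.ofReal (γ x) ^ p ≠ ∞) :
    ∫⁻ x, ENNReal.ofReal (g x) ^ p ≤ ∫⁻ x, ENNReal.ofReal (f x) ^ p := by
  have := hf.isProbabilityMeasure_prod hγ
  have := hg.isProbabilityMeasure_prod hγ
  have hk := antitone_ofReal_rpow (p := p - 1) (by linarith)
  have key := lintegral_le_of_antitone h hk
  rw [hf.lintegral_rpow_prod hγ p hk.measurable, hg.lintegral_rpow_prod hγ p hk.measurable] at key
  exact (ENNReal.mul_le_mul_iff_left (hγ.lintegral_rpow_ne_zero p) hγp).1 key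

/-- The positive part of `log M - log r`, and `∞` for `r ≤ 0`. -/
noncomputable def logDeficit (M r : ℝ) : ℝ≥0∞ :=
  if r ≤ 0 then ∞ else ENNReal.ofReal (log M - log r)

/-- The value `∞` on `r ≤ 0` is needed for this to hold on the whole line, where `log` itself is not
monotone. -/
lemma antitone_logDeficit (M : ℝ) : Antitone (logDeficit M) := by
  intro r r' h
  unfold logDeficit
  by_cases hr : r ≤ 0
  · simp [hr]
  · rw [if_neg hr, if_neg (by linarith)]
    exact ENNReal.ofReal_le_ofReal (sub_le_sub_left (log_le_log (not_le.1 hr) h) _)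

omit [NeZero (volume : Measure E)] in
-- The logarithm turns the product into a sum, both summands being nonnegative thanks to the bound
-- `M`; in each one the other density integrates to one.
lemma IsBoundedDensity.lintegral_logDeficit_prod (hf : IsBoundedDensity f M)
    (hγ : IsBoundedDensity γ M) :
    ∫⁻ r, logDeficit (M * M) r
        ∂densityLaw (volume : Measure (E × E)) (fun q => f q.1 * γ q.2)
      = entropyDeficit f M + entropyDeficit γ M := by
  have hfm := hf.measurable
  have hγm := hγ.measurable
  have hM : 0 < M := by linarith [hf.one_le]
  have m1 : Measurable fun x => ENNReal.ofReal (f x) * ENNReal.ofReal (log M - log (f x)) := by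
    fun_prop
  have m2 : Measurable fun x => ENNReal.ofReal (γ x) * ENNReal.ofReal (log M - log (γ x)) := by
    fun_prop
  have e1 := lintegral_prod_mul_volume m1 hγm.ennreal_ofReal
  have e2 := lintegral_prod_mul_volume hfm.ennreal_ofReal m2
  rw [hγ.lintegral_eq_one, mul_one] at e1
  rw [hf.lintegral_eq_one, one_mul] at e2
  rw [lintegral_densityLaw _ (hf.measurable_prod hγ) (antitone_logDeficit _).measurable,
    entropyDeficit, entropyDeficit, ← e1, ← e2, ← lintegral_add_left]
  · refine lintegral_congr fun q => ?_
    have h1 := hf.pos q.1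
    have h2 := hγ.pos q.2
    rw [logDeficit, if_neg (not_le.2 (mul_pos h1 h2)), log_mul hM.ne' hM.ne',
      log_mul h1.ne' h2.ne', add_sub_add_comm, ENNReal.ofReal_add
        (sub_nonneg.2 (hf.log_le _)) (sub_nonneg.2 (hγ.log_le _)), ENNReal.ofReal_mul h1.le]
    ring
  · exact (m1.comp measurable_fst).mul (hγm.ennreal_ofReal.comp measurable_snd)

omit [NeZero (volume : Measure E)] in
lemma IsBoundedDensity.entropyDeficit_le (hf : IsBoundedDensity f M)
    (hg : IsBoundedDensity g M) (hγ : IsBoundedDensity γ M)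
    (h : ∀ c, densityLaw (volume : Measure (E × E)) (fun q => f q.1 * γ q.2) (Ioi c)
      ≤ densityLaw (volume : Measure (E × E)) (fun q => g q.1 * γ q.2) (Ioi c))
    (hγE : entropyDeficit γ M ≠ ∞) : entropyDeficit g M ≤ entropyDeficit f M := by
  have := hf.isProbabilityMeasure_prod hγ
  have := hg.isProbabilityMeasure_prod hγ
  have key := lintegral_le_of_antitone h (antitone_logDeficit (M * M))
  rw [hf.lintegral_logDeficit_prod hγ, hg.lintegral_logDeficit_prod hγ] at key
  exact (ENNReal.add_le_add_iff_right hγE).1 key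

omit [NeZero (volume : Measure E)] in
-- With `m` the essential supremum of `g` and `y` a maximum point of `γ`, almost everywhere `g ⊗ γ ≤
-- m γ(y)`. By domination `f ⊗ γ` has no mass above this level. Its superlevel set is open and null,
-- hence empty; evaluating at `(x, y)` and cancelling `γ(y)` gives `f x ≤ m`.
lemma IsBoundedDensity.essSup_le [SecondCountableTopology E] [(volume : Measure E).IsOpenPosMeasure]
    (hf : IsBoundedDensity f M)
    (hg : IsBoundedDensity g M) (hγ : IsBoundedDensity γ M)
    (h : ∀ c, densityLaw (volume : Measure (E × E)) (fun q => f q.1 * γ q.2) (Ioi c)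
      ≤ densityLaw (volume : Measure (E × E)) (fun q => g q.1 * γ q.2) (Ioi c))
    {y : E} (hy : ∀ x, γ x ≤ γ y) :
    essSup (fun x => ENNReal.ofReal (f x)) volume
      ≤ essSup (fun x => ENNReal.ofReal (g x)) volume := by
  set m := essSup (fun x => ENNReal.ofReal (g x)) volume with hm
  have hmM : m ≤ ENNReal.ofReal M :=
    essSup_le_of_ae_le _ (Eventually.of_forall fun x => ENNReal.ofReal_le_ofReal (hg.le x))
  have hmt : m ≠ ∞ := ne_top_of_le_ne_top ENNReal.ofReal_ne_top hmM
  have hgm : ∀ᵐ x, g x ≤ m.toReal := by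
    filter_upwards [ENNReal.ae_le_essSup fun x => ENNReal.ofReal (g x)] with x hx
    exact (ENNReal.ofReal_le_iff_le_toReal hmt).1 hx
  have hgm' : ∀ᵐ q : E × E, g q.1 ≤ m.toReal :=
    Measure.quasiMeasurePreserving_fst.ae hgm
  set c := m.toReal * γ y with hc
  have hG0 : densityLaw (volume : Measure (E × E)) (fun q => g q.1 * γ q.2) (Ioi c) = 0 := by
    rw [densityLaw_Ioi _ (hg.measurable_prod hγ)]
    refine (lintegral_congr_ae ?_).trans lintegral_zero
    filter_upwards [hgm'] with q hq
    have : g q.1 * γ q.2 ≤ c :=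
      mul_le_mul hq (hy _) (hγ.pos _).le ENNReal.toReal_nonneg
    rw [indicator_of_notMem (by simpa using this)]
    simp
  have hF0 : densityLaw (volume : Measure (E × E)) (fun q => f q.1 * γ q.2) (Ioi c) = 0 :=
    le_antisymm ((h c).trans hG0.le) bot_le
  have hcont : Continuous fun q : E × E => f q.1 * γ q.2 :=
    (hf.continuous.comp continuous_fst).mul (hγ.continuous.comp continuous_snd)
  have hopen : IsOpen {q : E × E | c < f q.1 * γ q.2} := isOpen_lt continuous_const hcont
  have hnull : (volume : Measure (E × E)) {q : E × E | c < f q.1 * γ q.2} = 0 := by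
    have hm : Measurable fun q : E × E =>
        ENNReal.ofReal (f q.1 * γ q.2 * (Ioi c).indicator 1 (f q.1 * γ q.2)) :=
      ((hf.measurable_prod hγ).mul ((measurable_one.indicator measurableSet_Ioi).comp
        (hf.measurable_prod hγ))).ennreal_ofReal
    rw [densityLaw_Ioi _ (hf.measurable_prod hγ), lintegral_eq_zero_iff hm] at hF0
    refine measure_mono_null (fun q hq => ?_) (ae_iff.1 hF0)
    have h1 : c < f q.1 * γ q.2 := hq
    have h2 : 0 < f q.1 * γ q.2 := mul_pos (hf.pos _) (hγ.pos _)
    change ¬ _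
    simp [indicator, h1, h2]
  have : (volume : Measure (E × E)).IsOpenPosMeasure :=
    inferInstanceAs ((volume : Measure E).prod volume).IsOpenPosMeasure
  rw [hopen.measure_eq_zero_iff volume] at hnull
  refine essSup_le_of_ae_le _ (Eventually.of_forall fun x => ?_)
  refine (ENNReal.ofReal_le_iff_le_toReal hmt).2 (not_lt.1 fun hx => ?_)
  have : (x, y) ∈ {q : E × E | c < f q.1 * γ q.2} := mul_lt_mul_of_pos_right hx (hγ.pos y)
  rw [hnull] at this
  exact this

end Comparison

/-! ### Gaussian normalisation, the densities of the sums, and the entropy inequality -/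

section Law

variable {E : Type*} [NormedAddCommGroup E] [InnerProductSpace ℝ E] [FiniteDimensional ℝ E]
  [MeasurableSpace E] [BorelSpace E]

variable (E) in
/-- The constant that normalises `exp (-b ‖x‖²)` to a probability density on `E`. -/
noncomputable def gaussConst (b : ℝ) : ℝ := (∫ x : E, gaussBump b x)⁻¹

lemma integral_gaussBump_pos {b : ℝ} (hb : 0 < b) : 0 < ∫ x : E, gaussBump b x := by
  refine (integral_pos_iff_support_of_nonneg (fun x => (gaussBump_pos b x).le)
    (integrable_gaussBump hb)).2 ?_
  rw [show Function.support (gaussBump b : E → ℝ) = univ from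
    eq_univ_of_forall fun y => (gaussBump_pos _ _).ne']
  exact isOpen_univ.measure_pos volume univ_nonempty

lemma gaussConst_pos {b : ℝ} (hb : 0 < b) : 0 < gaussConst E b :=
  inv_pos.2 (integral_gaussBump_pos hb)

lemma lintegral_gaussConst_mul_gaussBump {b : ℝ} (hb : 0 < b) :
    ∫⁻ x : E, ENNReal.ofReal (gaussConst E b * gaussBump b x) = 1 := by
  rw [← ofReal_integral_eq_lintegral_ofReal ((integrable_gaussBump hb).const_mul _)
    (Eventually.of_forall fun x => (mul_pos (gaussConst_pos hb) (gaussBump_pos b x)).le),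
    integral_const_mul, gaussConst, inv_mul_cancel₀ (integral_gaussBump_pos hb).ne',
    ENNReal.ofReal_one]

lemma measurable_ofReal_gaussConst_mul_gaussBump (b : ℝ) :
    Measurable fun x : E => ENNReal.ofReal (gaussConst E b * gaussBump b x) :=
  ((measurable_gaussBump b).const_mul _).ennreal_ofReal

/-- Both sides are probability measures with characteristic function `exp (-s ‖t‖² / 2)`. -/
lemma stdGaussian_map_smul {s : ℝ} (hs : 0 < s) :
    (stdGaussian E).map (fun x => √s • x) = volume.withDensity fun x =>
      ENNReal.ofReal (gaussConst E (1 / (2 * s)) * gaussBump (1 / (2 * s)) x) := by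
  set b := 1 / (2 * s) with hbs
  have hb : 0 < b := by positivity
  have : IsProbabilityMeasure (volume.withDensity fun x : E =>
      ENNReal.ofReal (gaussConst E b * gaussBump b x)) :=
    ⟨by simpa using lintegral_gaussConst_mul_gaussBump hb⟩
  have : IsProbabilityMeasure ((stdGaussian E).map (fun x => √s • x)) :=
    Measure.isProbabilityMeasure_map (by fun_prop)
  refine Measure.ext_of_charFun (funext fun t => ?_)
  have hbc : 0 < (b : ℂ).re := by simpa using hb
  have h0 : ((∫ x : E, gaussBump b x : ℝ) : ℂ)
      = (π / b) ^ (Module.finrank ℝ E / 2 : ℂ) := by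
    rw [← GaussianFourier.integral_cexp_neg_mul_sq_norm hbc (V := E), ← integral_complex_ofReal]
    refine integral_congr_ae (Eventually.of_forall fun x => ?_)
    simp [gaussBump]
  have h1 : ((∫ x : E, gaussBump b x : ℝ) : ℂ) ≠ 0 :=
    Complex.ofReal_ne_zero.2 (integral_gaussBump_pos hb).ne'
  rw [charFun_map_smul, charFun_stdGaussian, charFun_apply,
    integral_withDensity_eq_integral_toReal_smul (measurable_ofReal_gaussConst_mul_gaussBump b)
      (Eventually.of_forall fun _ => ENNReal.ofReal_lt_top)]
  have h2 : ∀ x : E, (ENNReal.ofReal (gaussConst E b * gaussBump b x)).toReal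
        • Complex.exp (⟪x, t⟫_ℝ * Complex.I)
      = (gaussConst E b : ℂ) * Complex.exp (-b * ‖x‖ ^ 2 + Complex.I * ⟪t, x⟫_ℝ) := by
    intro x
    rw [ENNReal.toReal_ofReal (mul_pos (gaussConst_pos hb) (gaussBump_pos b x)).le,
      Complex.exp_add, Complex.real_smul, real_inner_comm, mul_comm Complex.I]
    simp [gaussBump]
    ring
  simp_rw [h2]
  rw [integral_const_mul, GaussianFourier.integral_cexp_neg_mul_sq_norm_add hbc, ← h0, ← mul_assoc,
    gaussConst, Complex.ofReal_inv, inv_mul_cancel₀ h1, one_mul, norm_smul,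
    Real.norm_of_nonneg (sqrt_nonneg s)]
  congr 1
  have hss : ((√s : ℝ) : ℂ) ^ 2 = s := by
    rw [← Complex.ofReal_pow, sq_sqrt hs.le]
  have hs0 : (s : ℂ) ≠ 0 := Complex.ofReal_ne_zero.2 hs.ne'
  rw [hbs]
  push_cast
  rw [mul_pow, hss, Complex.I_sq]
  field_simp
  ring

lemma conv_withDensity_gaussBump {b : ℝ} (hb : 0 < b) (μ : Measure E) [IsProbabilityMeasure μ] :
    μ ∗ (volume.withDensity fun x => ENNReal.ofReal (gaussConst E b * gaussBump b x))
      = volume.withDensity fun x => ENNReal.ofReal (gaussConst E b * gaussMix b μ id x) := by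
  have hd := measurable_ofReal_gaussConst_mul_gaussBump (E := E) b
  have : IsProbabilityMeasure (volume.withDensity fun x : E =>
      ENNReal.ofReal (gaussConst E b * gaussBump b x)) :=
    ⟨by simpa using lintegral_gaussConst_mul_gaussBump hb⟩
  have hC := (gaussConst_pos (E := E) hb).le
  refine Measure.ext_of_lintegral _ fun φ hφ => ?_
  rw [Measure.lintegral_conv hφ]
  have h1 : ∀ y : E, ∫⁻ z, φ (y + z) ∂(volume.withDensity fun x : E =>
      ENNReal.ofReal (gaussConst E b * gaussBump b x))
      = ∫⁻ x, ENNReal.ofReal (gaussConst E b * gaussBump b (x - y)) * φ x := by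
    intro y
    have hφy : Measurable fun z => φ (y + z) := hφ.comp (measurable_const_add y)
    rw [lintegral_withDensity_eq_lintegral_mul _ hd hφy,
      ← lintegral_sub_right_eq_self _ y]
    simp
  have hjoint : Measurable fun q : E × E =>
      ENNReal.ofReal (gaussConst E b * gaussBump b (q.2 - q.1)) * φ q.2 :=
    (hd.comp (measurable_snd.sub measurable_fst)).mul (hφ.comp measurable_snd)
  have hmix : Measurable fun x => ENNReal.ofReal (gaussConst E b * gaussMix b μ id x) :=
    ((continuous_gaussMix hb.le μ measurable_id).measurable.const_mul _).ennreal_ofReal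
  simp_rw [h1]
  rw [lintegral_lintegral_swap hjoint.aemeasurable,
    lintegral_withDensity_eq_lintegral_mul _ hmix hφ]
  refine lintegral_congr fun x => ?_
  have hx : Measurable fun y => ENNReal.ofReal (gaussBump b (x - y)) :=
    ((measurable_gaussBump b).comp (measurable_const_sub x)).ennreal_ofReal
  simp_rw [Pi.mul_apply, ENNReal.ofReal_mul hC, ofReal_gaussMix hb.le μ measurable_id]
  rw [lintegral_mul_const _ (hx.const_mul _), lintegral_const_mul _ hx]
  rfl

/-- The density of a random vector plus an independent Gaussian vector. -/
lemma map_add_smul_stdGaussian {Ω : Type*} [MeasurableSpace Ω] {P : Measure Ω}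
    [IsProbabilityMeasure P] {X Z : Ω → E} (hX : AEMeasurable X P)
    (hZ : HasLaw Z (stdGaussian E) P) (hXZ : IndepFun X Z P) {s : ℝ} (hs : 0 < s) :
    P.map (fun ω => X ω + √s • Z ω) = volume.withDensity fun x =>
      ENNReal.ofReal (gaussConst E (1 / (2 * s)) * gaussMix (1 / (2 * s)) (P.map X) id x) := by
  have hb : 0 < 1 / (2 * s) := by positivity
  have hsm : Measurable fun x : E => √s • x := measurable_const_smul _
  have hZ' : AEMeasurable (fun ω => √s • Z ω) P := hsm.comp_aemeasurable hZ.aemeasurable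
  have : IsProbabilityMeasure (P.map X) := Measure.isProbabilityMeasure_map hX
  have hlaw : P.map (fun ω => √s • Z ω) = (stdGaussian E).map fun x => √s • x := by
    rw [← hZ.map_eq, AEMeasurable.map_map_of_aemeasurable hsm.aemeasurable hZ.aemeasurable]
    rfl
  have h := IndepFun.map_add_eq_map_conv_map₀ hX hZ' (hXZ.comp measurable_id hsm)
  rw [hlaw, stdGaussian_map_smul hs, conv_withDensity_gaussBump hb] at h
  exact h

omit [FiniteDimensional ℝ E] in
lemma gaussMix_map {b : ℝ} (μ : Measure E) {T : E → E} (hT : Measurable T) :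
    gaussMix b (μ.map T) id = gaussMix b μ T := by
  funext x
  exact integral_map hT.aemeasurable
    ((measurable_gaussBump b).comp (measurable_const_sub x)).aestronglyMeasurable

lemma isBoundedDensity_gaussMix {b : ℝ} (hb : 0 < b) (μ : Measure E) [IsProbabilityMeasure μ]
    {S : E → E} (hS : Measurable S) :
    IsBoundedDensity (fun x => gaussConst E b * gaussMix b μ S x) (max 1 (gaussConst E b)) where
  continuous := (continuous_gaussMix hb.le μ hS).const_mul _
  pos x := mul_pos (gaussConst_pos hb) (gaussMix_pos hb.le μ hS x)
  le x := (mul_le_of_le_one_right (gaussConst_pos hb).le (gaussMix_le_one hb.le μ hS x)).trans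
    (le_max_right _ _)
  one_le := le_max_left _ _
  lintegral_eq_one := by
    have hC := (gaussConst_pos (E := E) hb).le
    rw [← lintegral_gaussConst_mul_gaussBump (E := E) hb]
    simp_rw [ENNReal.ofReal_mul hC]
    rw [lintegral_const_mul _ (continuous_gaussMix hb.le μ hS).measurable.ennreal_ofReal,
      lintegral_const_mul _ (measurable_gaussBump b).ennreal_ofReal, lintegral_gaussMix hb.le μ hS]

lemma isBoundedDensity_gaussBump {b : ℝ} (hb : 0 < b) :
    IsBoundedDensity (fun x : E => gaussConst E b * gaussBump b x) (max 1 (gaussConst E b)) where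
  continuous := (continuous_gaussBump b).const_mul _
  pos x := mul_pos (gaussConst_pos hb) (gaussBump_pos b x)
  le x := (mul_le_of_le_one_right (gaussConst_pos hb).le (gaussBump_le_one hb.le x)).trans
    (le_max_right _ _)
  one_le := le_max_left _ _
  lintegral_eq_one := lintegral_gaussConst_mul_gaussBump hb

lemma lintegral_gaussBump_rpow_ne_top {b : ℝ} (hb : 0 < b) {p : ℝ} (hp : 0 < p) :
    ∫⁻ x : E, ENNReal.ofReal (gaussConst E b * gaussBump b x) ^ p ≠ ∞ := by
  have hC := (gaussConst_pos (E := E) hb)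
  have e : ∀ x : E, ENNReal.ofReal (gaussConst E b * gaussBump b x) ^ p
      = ENNReal.ofReal (gaussConst E b ^ p) * ENNReal.ofReal (gaussBump (b * p) x) := by
    intro x
    rw [ENNReal.ofReal_rpow_of_pos (mul_pos hC (gaussBump_pos b x)),
      mul_rpow hC.le (gaussBump_pos b x).le, ENNReal.ofReal_mul (rpow_nonneg hC.le p)]
    congr 2
    rw [gaussBump, gaussBump, ← Real.exp_mul]
    congr 1
    ring
  simp_rw [e]
  rw [lintegral_const_mul _ (measurable_gaussBump _).ennreal_ofReal]
  exact ENNReal.mul_ne_top ENNReal.ofReal_ne_top (lintegral_gaussBump_ne_top (mul_pos hb hp))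

/-- The logarithm grows like `‖x‖²`, and half of the Gaussian exponent absorbs it. -/
lemma entropyDeficit_gaussBump_ne_top {b : ℝ} (hb : 0 < b) (M : ℝ) :
    entropyDeficit (fun x : E => gaussConst E b * gaussBump b x) M ≠ ∞ := by
  have hC := (gaussConst_pos (E := E) hb)
  set C := gaussConst E b with hCdef
  set L := |log M - log C| with hL
  have hle : entropyDeficit (fun x : E => C * gaussBump b x) M
      ≤ ∫⁻ x : E, ENNReal.ofReal (C * (L + 2)) * ENNReal.ofReal (gaussBump (b / 2) x) := by
    refine lintegral_mono fun x => ?_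
    have hB := gaussBump_pos b x
    rw [← ENNReal.ofReal_mul (mul_pos hC hB).le, ← ENNReal.ofReal_mul (by positivity)]
    refine ENNReal.ofReal_le_ofReal ?_
    -- The bump is `exp (-y)` twice. One copy bounds the logarithmic factor by `L + 2`, using `y exp
    -- (-y) ≤ 1`; the other remains as the integrable bump of parameter `b / 2`.
    set y := b / 2 * ‖x‖ ^ 2 with hy
    have hy0 : 0 ≤ y := by positivity
    have e1 : gaussBump b x = rexp (-y) * rexp (-y) := by
      rw [← Real.exp_add, gaussBump]
      congr 1
      rw [hy]
      ring
    have e2 : gaussBump (b / 2) x = rexp (-y) := by rw [gaussBump, hy, neg_mul]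
    have e3 : log (C * gaussBump b x) = log C - 2 * y := by
      rw [log_mul hC.ne' hB.ne', e1, ← Real.exp_add, log_exp]
      ring
    have h1 : y * rexp (-y) ≤ 1 := by
      have := mul_le_mul_of_nonneg_right (show y ≤ rexp y by linarith [add_one_le_exp y])
        (Real.exp_pos (-y)).le
      rwa [← Real.exp_add, add_neg_cancel, Real.exp_zero] at this
    have h2 : rexp (-y) ≤ 1 := Real.exp_le_one_iff.2 (by linarith)
    have h3 : (log M - log C) * rexp (-y) ≤ L := by
      calc (log M - log C) * rexp (-y) ≤ L * rexp (-y) := by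
            gcongr
            exact le_abs_self _
        _ ≤ L := mul_le_of_le_one_right (abs_nonneg _) h2
    have h4 : (log M - log C + 2 * y) * rexp (-y) ≤ L + 2 := by linarith
    rw [e3, e2, e1]
    have := mul_le_mul_of_nonneg_left h4 (mul_pos hC (Real.exp_pos (-y))).le
    calc C * (rexp (-y) * rexp (-y)) * (log M - (log C - 2 * y))
        = C * rexp (-y) * ((log M - log C + 2 * y) * rexp (-y)) := by ring
      _ ≤ C * rexp (-y) * (L + 2) := this
      _ = _ := by ring
  refine ne_top_of_le_ne_top ?_ hle
  rw [lintegral_const_mul _ (measurable_gaussBump _).ennreal_ofReal]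
  exact ENNReal.mul_ne_top ENNReal.ofReal_ne_top (lintegral_gaussBump_ne_top (by positivity))

lemma shannonPos_congr {f g : E → ℝ≥0∞} (h : f =ᵐ[volume] g) : shannonPos f = shannonPos g :=
  lintegral_congr_ae (h.mono fun x hx => by simp only [hx])

lemma shannonNeg_congr {f g : E → ℝ≥0∞} (h : f =ᵐ[volume] g) : shannonNeg f = shannonNeg g :=
  lintegral_congr_ae (h.mono fun x hx => by simp only [hx])

/-- Needed because `rnDeriv` agrees with an explicit density only almost everywhere. -/
lemma renyiEntropyOfDensity_congr (α : ℝ≥0∞) {f g : E → ℝ≥0∞} (h : f =ᵐ[volume] g) :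
    renyiEntropyOfDensity α f = renyiEntropyOfDensity α g := by
  have h1 : volume (Function.support f) = volume (Function.support g) := by
    refine measure_congr (h.mono fun x hx => ?_)
    change (f x ≠ 0) = (g x ≠ 0)
    rw [hx]
  have h2 : ∫⁻ x, f x ^ α.toReal = ∫⁻ x, g x ^ α.toReal :=
    lintegral_congr_ae (h.mono fun x hx => by simp only [hx])
  unfold renyiEntropyOfDensity
  rw [h1, h2, shannonPos_congr h, shannonNeg_congr h, essSup_congr_ae h]

lemma renyiEntropy_withDensity (α : ℝ≥0∞) {f : E → ℝ≥0∞} (hf : Measurable f) :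
    renyiEntropy α (volume.withDensity f) = renyiEntropyOfDensity α f :=
  renyiEntropyOfDensity_congr α (Measure.rnDeriv_withDensity _ hf)

lemma IsBoundedDensity.hasRenyiEntropy {f : E → ℝ} {M : ℝ} (hf : IsBoundedDensity f M)
    (α : ℝ≥0∞) : HasRenyiEntropy α (volume.withDensity fun x => ENNReal.ofReal (f x)) := by
  refine ⟨withDensity_absolutelyContinuous _ _, fun _ => Or.inr ?_⟩
  rw [shannonNeg_congr (Measure.rnDeriv_withDensity _ hf.measurable.ennreal_ofReal)]
  exact hf.shannonNeg_ne_top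

/-- Contracting the centres of a Gaussian mixture decreases its Rényi entropies. -/
theorem renyiEntropyOfDensity_gaussMix_le {b : ℝ} (hb : 0 < b) (μ : Measure E)
    [IsProbabilityMeasure μ] {T : E → E} (hT : LipschitzWith 1 T) (α : ℝ≥0∞) :
    renyiEntropyOfDensity α (fun x => ENNReal.ofReal (gaussConst E b * gaussMix b μ T x)) ≤
      renyiEntropyOfDensity α (fun x => ENNReal.ofReal (gaussConst E b * gaussMix b μ id x)) := by
  have hf := isBoundedDensity_gaussMix hb μ measurable_id
  have hg := isBoundedDensity_gaussMix hb μ hT.continuous.measurable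
  have hγ := isBoundedDensity_gaussBump (E := E) hb
  have h := densityLaw_gaussMix_mul_gaussBump_Ioi_le hb μ hT (gaussConst_pos (E := E) hb)
  have hsupp : ∀ {f : E → ℝ} {M : ℝ}, IsBoundedDensity f M →
      Function.support (fun x => ENNReal.ofReal (f x)) = univ := fun hf =>
    eq_univ_of_forall fun x => (ENNReal.ofReal_pos.2 (hf.pos x)).ne'
  unfold renyiEntropyOfDensity
  split_ifs with h0 h1 h2
  · rw [hsupp hf, hsupp hg]
  · exact hf.shannon_le hg (hf.entropyDeficit_le hg hγ h (entropyDeficit_gaussBump_ne_top hb _))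
  · rw [EReal.neg_le_neg_iff]
    refine ENNReal.log_monotone (hf.essSup_le hg hγ h (y := 0) fun x => ?_)
    refine mul_le_mul_of_nonneg_left ((gaussBump_le_one hb.le x).trans_eq ?_)
      (gaussConst_pos hb).le
    simp [gaussBump]
  · have hp : 0 < α.toReal := ENNReal.toReal_pos h0 h2
    have hp1 : α.toReal ≠ 1 := fun h => h1 ((ENNReal.toReal_eq_one_iff α).1 h)
    have hγp := lintegral_gaussBump_rpow_ne_top (E := E) hb hp
    -- The power integrals compare in opposite directions below and above order `1`, and so does the
    -- sign of `(1 - α)⁻¹`; the entropy inequality is the same.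
    rcases lt_or_gt_of_ne hp1 with hlt | hgt
    · refine mul_le_mul_of_nonneg_left (ENNReal.log_monotone
        (hf.lintegral_rpow_le_of_le_one hg hγ h hlt.le hγp)) ?_
      exact EReal.coe_nonneg.2 (inv_nonneg.2 (by linarith))
    · have hc : (((1 - α.toReal)⁻¹ : ℝ) : EReal) ≤ 0 :=
        EReal.coe_nonpos.2 (inv_nonpos.2 (by linarith))
      rw [mul_comm, mul_comm ((_ : ℝ) : EReal)]
      exact EReal.mul_le_mul_of_nonpos_right (ENNReal.log_monotone
        (hf.lintegral_rpow_le_of_one_le hg hγ h hgt.le hγp)) hc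

end Law

theorem mainTheorem1 (n : ℕ)
    (T : EuclideanSpace ℝ (Fin n) → EuclideanSpace ℝ (Fin n)) (hT : LipschitzWith 1 T)
    {Ω : Type*} [MeasurableSpace Ω] (P : Measure Ω) [IsProbabilityMeasure P]
    (X Z : Ω → EuclideanSpace ℝ (Fin n)) (hX : AEMeasurable X P)
    (hZ : HasLaw Z (stdGaussian (EuclideanSpace ℝ (Fin n))) P) (hXZ : IndepFun X Z P)
    (s : ℝ) (hs : 0 < s) (α : ℝ≥0∞)
    (hα : 1 ≤ α ∨ Integrable (fun ω => ‖X ω‖) P) :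
    HasRenyiEntropy α (P.map (fun ω => X ω + √s • Z ω)) ∧
    HasRenyiEntropy α (P.map (fun ω => T (X ω) + √s • Z ω)) ∧
    renyiEntropy α (P.map (fun ω => X ω + √s • Z ω)) ≥
      renyiEntropy α (P.map (fun ω => T (X ω) + √s • Z ω)) := by
  have hb : 0 < 1 / (2 * s) := by positivity
  have hTm := hT.continuous.measurable
  have : IsProbabilityMeasure (P.map X) := Measure.isProbabilityMeasure_map hX
  have hf := isBoundedDensity_gaussMix hb (P.map X) measurable_id
  have hg := isBoundedDensity_gaussMix hb (P.map X) hTm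
  have hlawT : P.map (fun ω => T (X ω)) = (P.map X).map T :=
    (AEMeasurable.map_map_of_aemeasurable hTm.aemeasurable hX).symm
  have e1 := map_add_smul_stdGaussian hX hZ hXZ hs
  have e2 := map_add_smul_stdGaussian (hTm.comp_aemeasurable hX) hZ
    (hXZ.comp hTm measurable_id) hs
  -- Both densities are now mixtures over the same law of `X`, with `T` acting on the centres only.
  rw [show P.map (T ∘ X) = (P.map X).map T from hlawT, gaussMix_map _ hTm] at e2
  simp only [Function.comp_apply] at e2
  rw [e1, e2]
  refine ⟨hf.hasRenyiEntropy α, hg.hasRenyiEntropy α, ?_⟩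
  rw [renyiEntropy_withDensity α hf.measurable.ennreal_ofReal,
    renyiEntropy_withDensity α hg.measurable.ennreal_ofReal]
  exact renyiEntropyOfDensity_gaussMix_le hb (P.map X) hT α
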